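/- Let $S^+=\mathbb Z^8$ with the symmetric bilinear form such that $(z,z)=2(z_1z_5+z_2z_6+z_3z_7+z_4z_8)$ (so $S^+\cong U^{\oplus 4}$), let $W=\mathbb Z^4$ with basis $e_1,\dots,e_4$ and $V=W\oplus W^*$. Identify $S^+_{\mathbb C}=\mathbb C^8$ with $\bigwedge^{even}W_{\mathbb C}$ through $$z\mapsto z_1+z_2\,e_1\wedge e_2+z_3\,e_1\wedge e_3+z_4\,e_1\wedge e_4+z_5\,e_1\wedge e_2\wedge e_3\wedge e_4-z_6\,e_3\wedge e_4+z_7\,e_2\wedge e_4-z_8\,e_2\wedge e_3,$$ and let $(w,w^*)\in V_{\mathbb C}$ act on $\bigwedge W_{\mathbb C}$ as exterior multiplication by $w$ plus contraction with $w^*$. Let $h,s\in S^+$ with $(h,s)=0$, $(h,h)>0$, $(s,s)>0$, put $H=\langle h,s\rangle^\perp\subset S^+$ (of rank $6$) and let $$\ell\in\Omega_{\{h,s\}^\perp}=\{\ell\in\mathbf P S^+_{\mathbb C}:\ (\ell,\ell)=0,\ (\ell,\bar\ell)>0,\ (\ell,h)=(\ell,s)=0\}.$$ * Let $Z_\ell\subset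 V_{\mathbb C}$ be the maximal isotropic subspace whose pure spinor is $\ell$, i.e. $Z_\ell=\{v\in V_{\mathbb C}: v\cdot\ell=0\}$, and let $\mathcal T_\ell=V_{\mathbb C}/(Z_\ell+V)$; that is, $H^1(\mathcal T_\ell,\mathbb Z)=V$ with $H^{1,0}(\mathcal T_\ell)=Z_\ell$. * Let $H_\ell$ be the polarized weight two Hodge structure on $H$ with $H^{2,0}_\ell=\mathbb C\ell$, $H_\ell^{0,2}=\mathbb C\bar\ell$, $H_\ell^{1,1}=(H_\ell^{2,0}\oplus H_\ell^{0,2})^\perp$. Let $C(H)^+$ be the even Clifford algebra of $H$ (with $x^2=(x,x)$ for $x\in H$), and let $f_1,f_2\in H_{\mathbb R}$ satisfy $(f_1,f_1)=1$ and $H^{2,0}_\ell=\mathbb C(f_1+if_2)$. Left multiplication by $f_1f_2$ (which does not depend on the choice of $f_1,f_2$) is a complex structure on $C(H)^+_{\mathbb R}$; let $C^{1,0}\subset C(H)^+_{\mathbb C}$ be its $i$-eigenspace. The Kuga–Satake variety of $H_\ell$ is the torus $A_\ell=C(H)^+_{\mathbb C}/(C^{1,0}+C(H)^+)$ attached to this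 weight one Hodge structure on $C(H)^+$. Then $\mathcal T_\ell$ is a complex torus of dimension $4$, $A_\ell$ is a complex torus of dimension $16$, and $A_\ell$ is isogenous to $\mathcal T_\ell^4$: there is a surjective homomorphism of complex tori $A_\ell\to\mathcal T_\ell^4$ with finite kernel. -/

import Mathlib

noncomputable section

namespace KugaSatakeSpinor

/-! ### Complex tori and isogenies -/

/-- `E / Λ` is a complex torus of dimension `g`: `E` is a complex vector space of dimension `g`
and `Λ` is a full lattice, that is, the `ℤ`-span of an `ℝ`-basis of `E`. -/
def IsComplexTorus {E : Type*} [AddCommGroup E] [Module ℂ E] (g : ℕ) (Λ : AddSubgroup E) : Prop :=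
  Module.finrank ℂ E = g ∧
    ∃ b : Module.Basis (Fin (2 * g)) ℝ E, AddSubgroup.closure (Set.range b) = Λ

/-- The complex torus `E / Λ` is isogenous to `E' / Λ'`: there is a homomorphism of complex tori
`E / Λ → E' / Λ'`, i.e. a homomorphism of groups that lifts to a `ℂ`-linear map `E → E'`,
which is surjective and has finite kernel. -/
def Isogenous {E E' : Type*} [AddCommGroup E] [Module ℂ E] [AddCommGroup E'] [Module ℂ E']
    (Λ : AddSubgroup E) (Λ' : AddSubgroup E') : Prop :=
  ∃ φ : E ⧸ Λ →+ E' ⧸ Λ',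
    (∃ F : E →ₗ[ℂ] E', ∀ x : E, φ (x : E ⧸ Λ) = (F x : E' ⧸ Λ')) ∧
      Function.Surjective φ ∧ Finite φ.ker

/-- The lattice `Λ ^ n` in `E ^ n`, so that `E ^ n / Λ ^ n` is the `n`-th power of `E / Λ`. -/
def powLattice {E : Type*} [AddCommGroup E] (n : ℕ) (Λ : AddSubgroup E) :
    AddSubgroup (Fin n → E) :=
  AddSubgroup.pi Set.univ (fun _ => Λ)

/-- A weight one Hodge structure is given by a complex vector space `M = Λ_ℂ` containing the
group `Λ` and by the subspace `F = Λ^{1,0}` of `M`. The attached torus is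
`Λ_ℂ / (Λ^{1,0} + Λ)`; this is the image of `Λ` in its universal covering space
`Λ_ℂ / Λ^{1,0}`. -/
def periodLattice {M : Type*} [AddCommGroup M] [Module ℂ M] (F : Submodule ℂ M)
    (Λ : AddSubgroup M) : AddSubgroup (M ⧸ F) :=
  Λ.map F.mkQ.toAddMonoidHom

/-! ### The lattice `S⁺`, the period domain and the orthogonal complement of `h, s` -/

/-- The bilinear form on `S⁺ ⊗ R = R⁸`, with
`(z, z) = 2 (z₁ z₅ + z₂ z₆ + z₃ z₇ + z₄ z₈)`. -/
def spinForm (R : Type*) [CommRing R] : LinearMap.BilinForm R (Fin 8 → R) :=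
  LinearMap.mk₂ R
    (fun z w => z 0 * w 4 + z 4 * w 0 + z 1 * w 5 + z 5 * w 1 + z 2 * w 6 + z 6 * w 2
      + z 3 * w 7 + z 7 * w 3)
    (by intros; simp only [Pi.add_apply]; ring)
    (by intros; simp only [Pi.smul_apply, smul_eq_mul]; ring)
    (by intros; simp only [Pi.add_apply]; ring)
    (by intros; simp only [Pi.smul_apply, smul_eq_mul]; ring)

/-- Coordinatewise extension of scalars `R⁸ → R'⁸`. -/
def extend {R : Type*} (R' : Type*) [CommRing R] [CommRing R'] [Algebra R R'] :
    (Fin 8 → R) →ₗ[R] (Fin 8 → R') where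
  toFun z i := algebraMap R R' (z i)
  map_add' z w := by ext i; simp
  map_smul' r z := by ext i; simp [Algebra.smul_def]

lemma spinForm_extend {R : Type*} (R' : Type*) [CommRing R] [CommRing R'] [Algebra R R']
    (z w : Fin 8 → R) :
    spinForm R' (extend R' z) (extend R' w) = algebraMap R R' (spinForm R z w) := by
  simp [spinForm, extend]

/-- The domain of all `ℓ ∈ ℙ(S⁺_ℂ)` with `(ℓ, ℓ) = 0`, `(ℓ, ℓ̄) > 0`, `(ℓ, h) = (ℓ, s) = 0`
(the number `(ℓ, ℓ̄)` is always real). -/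
def periodDomain (h s : Fin 8 → ℤ) : Set (Projectivization ℂ (Fin 8 → ℂ)) :=
  {l | spinForm ℂ l.rep l.rep = 0 ∧ 0 < (spinForm ℂ l.rep (star l.rep)).re ∧
    spinForm ℂ l.rep (extend ℂ h) = 0 ∧ spinForm ℂ l.rep (extend ℂ s) = 0}

/-- `H ⊗ R`, where `H = ⟨h, s⟩^⊥ ⊆ S⁺`, as the orthogonal complement of `h, s` in `R⁸`;
`R = ℤ` gives `H` itself. -/
def orthLattice (R : Type*) [CommRing R] (h s : Fin 8 → ℤ) : Submodule R (Fin 8 → R) where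
  carrier := {x | spinForm R x (extend R h) = 0 ∧ spinForm R x (extend R s) = 0}
  add_mem' := by
    rintro x y ⟨hx, hx'⟩ ⟨hy, hy'⟩
    simp [hx, hx', hy, hy']
  zero_mem' := by simp
  smul_mem' := by
    rintro c x ⟨hx, hx'⟩
    simp [hx, hx']

/-- The quadratic form `Q(x) = (x, x)` on `H ⊗ R`. -/
def orthForm (R : Type*) [CommRing R] (h s : Fin 8 → ℤ) :
    QuadraticForm R (orthLattice R h s) :=
  (LinearMap.BilinMap.toQuadraticMap (spinForm R)).comp (orthLattice R h s).subtype

lemma extend_extend {R : Type*} (R' : Type*) [CommRing R] [CommRing R'] [Algebra R R']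
    (h : Fin 8 → ℤ) : extend R' (extend R h) = extend R' h := by
  ext i; simp [extend]

/-- The natural map `H ⊗ R → H ⊗ R'`. -/
def orthExtend {R : Type*} (R' : Type*) [CommRing R] [CommRing R'] [Algebra R R']
    (h s : Fin 8 → ℤ) : orthLattice R h s →ₗ[R] orthLattice R' h s where
  toFun x := ⟨extend R' x.1, by
    have hx := x.2
    refine ⟨?_, ?_⟩
    · rw [← extend_extend (R := R) R' h, spinForm_extend, hx.1, map_zero]
    · rw [← extend_extend (R := R) R' s, spinForm_extend, hx.2, map_zero]⟩
  map_add' x y := by ext i; simp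
  map_smul' r x := by ext i; simp [extend, Algebra.smul_def]

lemma orthForm_orthExtend {R : Type*} (R' : Type*) [CommRing R] [CommRing R'] [Algebra R R']
    (h s : Fin 8 → ℤ) (x : orthLattice R h s) :
    orthForm R' h s (orthExtend R' h s x) = algebraMap R R' (orthForm R h s x) :=
  spinForm_extend R' x.1 x.1

/-! ### The spinor map and the torus `T_ℓ` -/

/-- `V_ℂ = W_ℂ ⊕ W_ℂ^*`, with `W = ℤ⁴`; the second factor holds the coordinates with respect to
the dual basis. -/
abbrev VC : Type := (Fin 4 → ℂ) × (Fin 4 → ℂ)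

/-- The lattice `V = W ⊕ W^*` in `V_ℂ`. -/
def latticeV : AddSubgroup VC where
  carrier := {v | ∃ a b : Fin 4 → ℤ, v = (fun i => (a i : ℂ), fun i => (b i : ℂ))}
  add_mem' := by
    rintro _ _ ⟨a, b, rfl⟩ ⟨a', b', rfl⟩
    exact ⟨a + a', b + b', by ext <;> simp⟩
  zero_mem' := ⟨0, 0, by ext <;> simp⟩
  neg_mem' := by
    rintro _ ⟨a, b, rfl⟩
    exact ⟨-a, -b, by ext <;> simp⟩

/-- The basis vector `e_i` of `W`, as an element of `⋀ W_ℂ`. -/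
def e (i : Fin 4) : ExteriorAlgebra ℂ (Fin 4 → ℂ) :=
  ExteriorAlgebra.ι ℂ (Pi.single i 1)

/-- The identification `S⁺_ℂ = ℂ⁸ ≅ ⋀^even W_ℂ`; in these coordinates the subspace
`{(B w^*, w^*)}`, with `B` an alternating matrix, has the pure spinor
`exp(ω_B) = (1 : b₁₂ : b₁₃ : b₁₄ : b₁₂b₃₄ - b₁₃b₂₄ + b₁₄b₂₃ : -b₃₄ : b₂₄ : -b₂₃)`. -/
def spinor (z : Fin 8 → ℂ) : ExteriorAlgebra ℂ (Fin 4 → ℂ) :=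
  z 0 • 1 + z 1 • (e 0 * e 1) + z 2 • (e 0 * e 2) + z 3 • (e 0 * e 3)
    + z 4 • (e 0 * e 1 * e 2 * e 3)
    - z 5 • (e 2 * e 3) + z 6 • (e 1 * e 3) - z 7 • (e 1 * e 2)

/-- The action of `(w, w^*) ∈ V_ℂ` on the spinor module `⋀ W_ℂ` of the Clifford algebra of `V_ℂ`:
`w` acts by the exterior product and `w^*` by contraction. -/
def cliffordAct (v : VC) (x : ExteriorAlgebra ℂ (Fin 4 → ℂ)) : ExteriorAlgebra ℂ (Fin 4 → ℂ) :=
  ExteriorAlgebra.ι ℂ v.1 * x + CliffordAlgebra.contractLeft (dotProductEquiv ℂ (Fin 4) v.2) x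

lemma e_mul_e (i j : Fin 4) : e i * e j = - (e j * e i) := by
  rw [eq_neg_iff_add_eq_zero]
  exact ExteriorAlgebra.ι_add_mul_swap _ _

/-- For an alternating matrix `B = (b_ij)` the subspace `Z_B = {(B w^*, w^*)}` annihilates the
spinor with coordinates the Pfaffians of `B` listed above. -/
lemma cliffordAct_graph (b12 b13 b14 b23 b24 b34 : ℂ) (v : VC)
   (h1 : v.1 0 = b12 * v.2 1 + b13 * v.2 2 + b14 * v.2 3)
   (h2 : v.1 1 = -b12 * v.2 0 + b23 * v.2 2 + b24 * v.2 3)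
   (h3 : v.1 2 = -b13 * v.2 0 - b23 * v.2 1 + b34 * v.2 3)
   (h4 : v.1 3 = -b14 * v.2 0 - b24 * v.2 1 - b34 * v.2 2) :
   cliffordAct v (spinor ![1,b12,b13,b14,b12*b34-b13*b24+b14*b23,-b34,b24,-b23]) = 0 := by
  have hv : ExteriorAlgebra.ι ℂ v.1 = v.1 0 • e 0 + v.1 1 • e 1 + v.1 2 • e 2 + v.1 3 • e 3 := by
    simp only [e, ← map_smul, ← map_add]
    congr 1
    ext i; fin_cases i <;> simp
  have hc : ∀ (d : Module.Dual ℂ (Fin 4 → ℂ)) i x, CliffordAlgebra.contractLeft (Q := (0 : QuadraticForm ℂ (Fin 4 → ℂ))) d (e i * x) = d (Pi.single i 1) • x - e i * CliffordAlgebra.contractLeft (Q := (0 : QuadraticForm ℂ (Fin 4 → ℂ))) d x := by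
    intro d i x
    exact CliffordAlgebra.contractLeft_ι_mul (Q := (0 : QuadraticForm ℂ (Fin 4 → ℂ))) (d := d) _ _
  have hc1 : ∀ (d : Module.Dual ℂ (Fin 4 → ℂ)) i, CliffordAlgebra.contractLeft (Q := (0 : QuadraticForm ℂ (Fin 4 → ℂ))) d (e i) = d (Pi.single i 1) • 1 := by
    intro d i
    exact (CliffordAlgebra.contractLeft_ι (Q := (0 : QuadraticForm ℂ (Fin 4 → ℂ))) (d := d) _).trans (Algebra.algebraMap_eq_smul_one _)
  have sq : ∀ i, e i * e i = 0 := fun i => ExteriorAlgebra.ι_sq_zero _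
  have sq' : ∀ i x, e i * (e i * x) = 0 := fun i x => by rw [← mul_assoc, sq, zero_mul]
  have an : ∀ i j, j < i → e i * e j = - (e j * e i) := fun i j _ => e_mul_e i j
  have an' : ∀ i j x, j < i → e i * (e j * x) = - (e j * (e i * x)) := fun i j x _ => by
    rw [← mul_assoc, e_mul_e i j, neg_mul, mul_assoc]
  have hone : ∀ (d : Module.Dual ℂ (Fin 4 → ℂ)), CliffordAlgebra.contractLeft (Q := (0 : QuadraticForm ℂ (Fin 4 → ℂ))) d 1 = 0 := fun d => CliffordAlgebra.contractLeft_one (Q := (0 : QuadraticForm ℂ (Fin 4 → ℂ))) (d := d)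
  unfold cliffordAct spinor
  rw [hv, h1, h2, h3, h4]
  simp only [mul_assoc, map_add, map_sub, map_smul, hc, hc1, hone]
  simp [mul_add, add_mul, mul_sub, sq, sq', an, an']
  module
/-- The maximal isotropic subspace `Z_ℓ` of `V_ℂ` which the spinor map sends to `ℓ`: it consists
of the vectors which annihilate the pure spinor `ℓ`. -/
def isotropicSpace (l : Projectivization ℂ (Fin 8 → ℂ)) : Submodule ℂ VC where
  carrier := {v | cliffordAct v (spinor l.rep) = 0}
  add_mem' := by
    intro v w hv hw
    have h : cliffordAct (v + w) (spinor l.rep)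
        = cliffordAct v (spinor l.rep) + cliffordAct w (spinor l.rep) := by
      simp only [cliffordAct, Prod.fst_add, Prod.snd_add, map_add, add_mul,
        LinearMap.add_apply]
      abel
    simp only [Set.mem_ofPred_eq] at hv hw ⊢
    rw [h, hv, hw, add_zero]
  zero_mem' := by simp [cliffordAct]
  smul_mem' := by
    intro c v hv
    have h : cliffordAct (c • v) (spinor l.rep) = c • cliffordAct v (spinor l.rep) := by
      simp only [cliffordAct, Prod.smul_fst, Prod.smul_snd, map_smul, smul_mul_assoc,
        LinearMap.smul_apply, smul_add]
    simp only [Set.mem_ofPred_eq] at hv ⊢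
    rw [h, hv, smul_zero]

/-- The lattice of the torus `T_ℓ = V_ℂ / (Z_ℓ + V)`, for which `H¹(T_ℓ, ℤ) = V` and
`H^{1,0}(T_ℓ) = Z_ℓ`. -/
def torusT (l : Projectivization ℂ (Fin 8 → ℂ)) : AddSubgroup (VC ⧸ isotropicSpace l) :=
  periodLattice (isotropicSpace l) latticeV

/-! ### The Kuga-Satake torus `A_ℓ` -/

/-- `C(H)^+ ⊗ R`, the even Clifford algebra of `H ⊗ R` for the relation `x² = (x, x)`. -/
abbrev EvenCl (R : Type) [CommRing R] (h s : Fin 8 → ℤ) : Type :=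
  CliffordAlgebra.even (orthForm R h s)

/-- The natural map `C(H) → C(H_ℂ)`. -/
def cliffordExtend (h s : Fin 8 → ℤ) :
    CliffordAlgebra (orthForm ℤ h s) →ₐ[ℤ] CliffordAlgebra (orthForm ℂ h s) :=
  CliffordAlgebra.lift (orthForm ℤ h s)
    ⟨((CliffordAlgebra.ι (orthForm ℂ h s)).restrictScalars ℤ).comp (orthExtend ℂ h s), by
      intro x
      simp only [LinearMap.comp_apply, LinearMap.restrictScalars_apply]
      rw [CliffordAlgebra.ι_sq_scalar, orthForm_orthExtend]
      simp⟩

/-- The lattice `C(H)^+` in `C(H)^+ ⊗ ℂ`. -/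
def evenLattice (h s : Fin 8 → ℤ) : AddSubgroup (EvenCl ℂ h s) where
  carrier := {x | ∃ y ∈ CliffordAlgebra.even (orthForm ℤ h s), cliffordExtend h s y = x.1}
  add_mem' := by
    rintro x x' ⟨y, hy, hx⟩ ⟨y', hy', hx'⟩
    exact ⟨y + y', add_mem hy hy', by simp [hx, hx']⟩
  zero_mem' := ⟨0, zero_mem _, by simp⟩
  neg_mem' := by
    rintro x ⟨y, hy, hx⟩
    exact ⟨-y, neg_mem hy, by simp [hx]⟩

/-- `f₁, f₂ ∈ H_ℝ` is a normalized basis for the Hodge structure `H_ℓ`: one has `(f₁, f₁) = 1`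
and `H_ℓ^{2,0} = ℂ ℓ` is spanned by `f₁ + i f₂`. -/
def IsNormalizedPair (h s : Fin 8 → ℤ) (l : Projectivization ℂ (Fin 8 → ℂ))
    (f₁ f₂ : orthLattice ℝ h s) : Prop :=
  orthForm ℝ h s f₁ = 1 ∧
    Submodule.span ℂ {extend ℂ f₁.1 + Complex.I • extend ℂ f₂.1} = l.submodule

/-- Normalized pairs exist. -/
lemma exists_isNormalizedPair (h s : Fin 8 → ℤ) (l : Projectivization ℂ (Fin 8 → ℂ))
    (hl : l ∈ periodDomain h s) : ∃ f₁ f₂, IsNormalizedPair h s l f₁ f₂ := by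
  obtain ⟨h1, h2, h3, h4⟩ := hl
  set z := l.rep with hz
  have key : ∀ w : Fin 8 → ℤ, spinForm ℂ z (extend ℂ w) = 0 →
      spinForm ℝ (fun i => (z i).re) (extend ℝ w) = 0 ∧
      spinForm ℝ (fun i => (z i).im) (extend ℝ w) = 0 := by
    intro w hw
    constructor
    · have := congrArg Complex.re hw
      simpa [spinForm, extend] using this
    · have := congrArg Complex.im hw
      simpa [spinForm, extend] using this
  set N := spinForm ℝ (fun i => (z i).re) (fun i => (z i).re) with hN
  have hre := congrArg Complex.re h1
  have hNpos : 0 < N := by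
    simp [spinForm] at hre h2 hN
    nlinarith
  have hs : Real.sqrt N ≠ 0 := (Real.sqrt_pos.2 hNpos).ne'
  refine ⟨(Real.sqrt N)⁻¹ • ⟨fun i => (z i).re, (key h h3).1, (key s h4).1⟩,
    (Real.sqrt N)⁻¹ • ⟨fun i => (z i).im, (key h h3).2, (key s h4).2⟩, ?_, ?_⟩
  · change spinForm ℝ ((Real.sqrt N)⁻¹ • fun i => (z i).re) ((Real.sqrt N)⁻¹ • fun i => (z i).re) = 1
    rw [map_smul, map_smul, LinearMap.smul_apply, ← hN, smul_eq_mul, smul_eq_mul]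
    field_simp
    rw [Real.sq_sqrt hNpos.le]
  · rw [Projectivization.submodule_eq, ← hz]
    have : extend ℂ ((Real.sqrt N)⁻¹ • fun i => (z i).re) +
        Complex.I • extend ℂ ((Real.sqrt N)⁻¹ • fun i => (z i).im)
        = ((Real.sqrt N : ℂ))⁻¹ • z := by
      ext i
      simp [extend]
      conv_rhs => rw [← Complex.re_add_im (z i)]
      ring
    change Submodule.span ℂ {extend ℂ ((Real.sqrt N)⁻¹ • fun i => (z i).re) +
        Complex.I • extend ℂ ((Real.sqrt N)⁻¹ • fun i => (z i).im)} = _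
    rw [this]
    exact Submodule.span_singleton_smul_eq (IsUnit.mk0 _ (by simpa using hs)) z

/-- The `(1,0)`-part of the Kuga-Satake Hodge structure on `C(H)^+`: the subspace of
`C(H)^+ ⊗ ℂ` on which the complex structure, left multiplication by `f₁ f₂`, is multiplication
by `i`. The product `f₁ f₂` does not depend on the choice of the normalized pair. -/
def kugaSatakeOneZero (h s : Fin 8 → ℤ) (l : Projectivization ℂ (Fin 8 → ℂ)) :
    Submodule ℂ (EvenCl ℂ h s) where
  carrier := {x | ∀ f₁ f₂ : orthLattice ℝ h s, IsNormalizedPair h s l f₁ f₂ →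
    CliffordAlgebra.ι (orthForm ℂ h s) (orthExtend ℂ h s f₁)
      * CliffordAlgebra.ι (orthForm ℂ h s) (orthExtend ℂ h s f₂)
      * (x : CliffordAlgebra (orthForm ℂ h s)) = Complex.I • x.1}
  add_mem' := by
    intro x y hx hy f₁ f₂ hf
    have h1 := hx f₁ f₂ hf
    have h2 := hy f₁ f₂ hf
    simp only [Subalgebra.coe_add, mul_add, smul_add]
    rw [h1, h2]
  zero_mem' := by
    intro f₁ f₂ _
    simp
  smul_mem' := by
    intro c x hx f₁ f₂ hf
    have h1 := hx f₁ f₂ hf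
    simp only [Subalgebra.coe_smul, mul_smul_comm]
    rw [h1, smul_comm]

/-- The lattice of the Kuga-Satake variety `A_ℓ` of `H_ℓ`, the torus attached to the weight one
Hodge structure on `C(H)^+`. -/
def kugaSatakeA (h s : Fin 8 → ℤ) (l : Projectivization ℂ (Fin 8 → ℂ)) :
    AddSubgroup (EvenCl ℂ h s ⧸ kugaSatakeOneZero h s l) :=
  periodLattice (kugaSatakeOneZero h s l) (evenLattice h s)

end KugaSatakeSpinor

end

/-! By triality, Clifford multiplication by `z` in S⁺ maps V to S⁻ (matrix `gam z`) and S⁻ back to V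
(matrix `gamDual z`), with `gamDual z * gam z = (z, z)`. Products γ*(x)γ(y) with x, y in H therefore
make V a module over C(H)⁺, by integral matrices.

Hodge structures. Z_ℓ is the kernel of γ(ℓ) on V_ℂ (`mem_isotropicSpace`). Since ℓ is proportional
to f₁ + i f₂ and γ*(f₁)γ(f₁) = 1, multiplying γ(f₁)v + iγ(f₂)v = 0 by iγ*(f₁) turns it into
γ*(f₁)γ(f₂)v = iv (`exists_complexStructure`). So Z_ℓ is the i-eigenspace of f₁f₂ acting on V,
exactly as C^{1,0} is the i-eigenspace of f₁f₂ acting on C(H)⁺. It remains to compare C(H)⁺ with V⁴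
as C(H)⁺-modules, up to finite index.

Comparison. The element J = γ*(h)γ(s) is an integral matrix with J² = -(h,h)(s,s), and it commutes
with C(H)⁺ because h and s are orthogonal to H. As J² is a negative scalar, four standard basis
vectors v₁, ..., v₄ of V = ℤ⁸ can be chosen such that the vᵢ and Jvᵢ span V_ℝ. An element a of
C(H)⁺_ℂ killing all vᵢ also kills all Jvᵢ, hence acts as 0 on V_ℂ, hence is 0 because the action is
faithful (`eq_zero_of_mem_even`). So a ↦ (av₁, ..., av₄) is injective, and it is an isomorphism onto
V_ℂ⁴ since both sides have dimension 32 (`exists_evenCl_equiv`). It is C(H)⁺-linear, so it matches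
the Hodge structures, and it sends C(H)⁺ to a full-rank subgroup of V⁴, necessarily of finite index
(`exists_basis_of_integral`). This is the isogeny. -/

noncomputable section

namespace KugaSatakeSpinor

/-! ### The Clifford action of `S⁺` on `V` and the half-spin space `S⁻` in matrix form -/

/-- The alternating matrix of the two-form `z₁ e₀₁ + z₂ e₀₂ + z₃ e₀₃ - z₅ e₂₃ + z₆ e₁₃ - z₇ e₁₂`. -/
def altMatrix {R : Type*} [CommRing R] (z : Fin 8 → R) : Matrix (Fin 4) (Fin 4) R :=
  !![0, z 1, z 2, z 3; -z 1, 0, -z 7, z 6; -z 2, z 7, 0, -z 5; -z 3, -z 6, z 5, 0]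

/-- The Hodge dual of `altMatrix`. -/
def altMatrixDual {R : Type*} [CommRing R] (z : Fin 8 → R) : Matrix (Fin 4) (Fin 4) R :=
  !![0, -z 5, -z 6, -z 7; z 5, 0, z 3, -z 2; z 6, -z 3, 0, z 1; z 7, z 2, -z 1, 0]

/-- Clifford multiplication `V → S⁻` by an element of `S⁺`. -/
def gam {R : Type*} [CommRing R] (z : Fin 8 → R) : Matrix (Fin 4 ⊕ Fin 4) (Fin 4 ⊕ Fin 4) R :=
  Matrix.fromBlocks (z 0 • 1) (-altMatrix z) (altMatrixDual z) (z 4 • 1)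

/-- Clifford multiplication `S⁻ → V` by an element of `S⁺`, normalized such that
`gamDual z * gam z = (z, z)`. -/
def gamDual {R : Type*} [CommRing R] (z : Fin 8 → R) :
    Matrix (Fin 4 ⊕ Fin 4) (Fin 4 ⊕ Fin 4) R :=
  (2 : R) • Matrix.fromBlocks (z 4 • 1) (altMatrix z) (-altMatrixDual z) (z 0 • 1)

section

variable {R : Type*} [CommRing R]

lemma altMatrix_add (z w : Fin 8 → R) : altMatrix (z + w) = altMatrix z + altMatrix w := by
  ext i j; fin_cases i <;> fin_cases j <;> simp [altMatrix] <;> ring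

lemma altMatrix_smul (c : R) (z : Fin 8 → R) : altMatrix (c • z) = c • altMatrix z := by
  ext i j; fin_cases i <;> fin_cases j <;> simp [altMatrix]

lemma altMatrixDual_add (z w : Fin 8 → R) :
    altMatrixDual (z + w) = altMatrixDual z + altMatrixDual w := by
  ext i j; fin_cases i <;> fin_cases j <;> simp [altMatrixDual] <;> ring

lemma altMatrixDual_smul (c : R) (z : Fin 8 → R) :
    altMatrixDual (c • z) = c • altMatrixDual z := by
  ext i j; fin_cases i <;> fin_cases j <;> simp [altMatrixDual]

/-- An alternating 4 × 4 matrix times its Hodge dual is, up to sign, its Pfaffian times the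
identity; the scalar here is minus the Pfaffian of `altMatrix z`. -/
lemma altMatrix_mul_dual (z : Fin 8 → R) :
    altMatrix z * altMatrixDual z = (z 1 * z 5 + z 2 * z 6 + z 3 * z 7) • 1 := by
  ext i j
  fin_cases i <;> fin_cases j <;>
    simp [altMatrix, altMatrixDual, Matrix.mul_apply, Fin.sum_univ_four] <;> ring

lemma altMatrixDual_mul (z : Fin 8 → R) :
    altMatrixDual z * altMatrix z = (z 1 * z 5 + z 2 * z 6 + z 3 * z 7) • 1 := by
  ext i j
  fin_cases i <;> fin_cases j <;>
    simp [altMatrix, altMatrixDual, Matrix.mul_apply, Fin.sum_univ_four] <;> ring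

lemma gam_add (z w : Fin 8 → R) : gam (z + w) = gam z + gam w := by
  simp only [gam, altMatrix_add, altMatrixDual_add, Matrix.fromBlocks_add, Pi.add_apply, add_smul,
    neg_add]

lemma gam_smul (c : R) (z : Fin 8 → R) : gam (c • z) = c • gam z := by
  simp only [gam, altMatrix_smul, altMatrixDual_smul, Matrix.fromBlocks_smul, Pi.smul_apply,
    smul_assoc, smul_neg]

lemma gamDual_add (z w : Fin 8 → R) : gamDual (z + w) = gamDual z + gamDual w := by
  simp only [gamDual, altMatrix_add, altMatrixDual_add, Matrix.fromBlocks_add, Pi.add_apply,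
    add_smul, neg_add, ← smul_add]

lemma spinForm_apply (z w : Fin 8 → R) :
    spinForm R z w = z 0 * w 4 + z 4 * w 0 + z 1 * w 5 + z 5 * w 1 + z 2 * w 6 + z 6 * w 2
      + z 3 * w 7 + z 7 * w 3 := rfl

lemma spinForm_comm (z w : Fin 8 → R) : spinForm R z w = spinForm R w z := by
  simp only [spinForm_apply]; ring

lemma gamDual_mul_gam_self (z : Fin 8 → R) : gamDual z * gam z = spinForm R z z • 1 := by
  rw [gamDual, gam, Matrix.smul_mul, Matrix.fromBlocks_multiply]
  simp only [Matrix.smul_mul, Matrix.mul_smul, one_mul, mul_one, Matrix.mul_neg, Matrix.neg_mul,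
    neg_neg, altMatrix_mul_dual, altMatrixDual_mul, smul_smul, ← add_smul, smul_neg,
    neg_add_cancel]
  rw [show spinForm R z z = 2 * (z 4 * z 0 + (z 1 * z 5 + z 2 * z 6 + z 3 * z 7)) by
    rw [spinForm_apply]; ring, mul_smul, ← Matrix.fromBlocks_one]
  simp only [Matrix.fromBlocks_smul, smul_zero]
  congr 1 <;> module

lemma gam_mul_gamDual_self (z : Fin 8 → R) : gam z * gamDual z = spinForm R z z • 1 := by
  rw [gamDual, gam, Matrix.mul_smul, Matrix.fromBlocks_multiply]
  simp only [Matrix.smul_mul, Matrix.mul_smul, one_mul, mul_one, Matrix.mul_neg, Matrix.neg_mul,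
    neg_neg, altMatrix_mul_dual, altMatrixDual_mul, smul_smul, ← add_smul, smul_neg]
  rw [show spinForm R z z = 2 * (z 0 * z 4 + (z 1 * z 5 + z 2 * z 6 + z 3 * z 7)) by
    rw [spinForm_apply]; ring, mul_smul, ← Matrix.fromBlocks_one]
  simp only [Matrix.fromBlocks_smul, smul_zero, add_neg_cancel]
  congr 1 <;> module

lemma gamDual_mul_gam_add (z w : Fin 8 → R) :
    gamDual z * gam w + gamDual w * gam z = (2 * spinForm R z w) • 1 := by
  have h := gamDual_mul_gam_self (z + w)
  rw [gam_add, gamDual_add, add_mul, mul_add, mul_add, gamDual_mul_gam_self,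
    gamDual_mul_gam_self] at h
  simp only [map_add, LinearMap.add_apply, spinForm_comm w z] at h
  rw [← sub_eq_zero] at h ⊢
  rw [← h]
  module

lemma gam_mul_gamDual_add (z w : Fin 8 → R) :
    gam z * gamDual w + gam w * gamDual z = (2 * spinForm R z w) • 1 := by
  have h := gam_mul_gamDual_self (z + w)
  rw [gam_add, gamDual_add, add_mul, mul_add, mul_add, gam_mul_gamDual_self,
    gam_mul_gamDual_self] at h
  simp only [map_add, LinearMap.add_apply, spinForm_comm w z] at h
  rw [← sub_eq_zero] at h ⊢
  rw [← h]
  module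

lemma gam_extend {R' : Type*} [CommRing R'] [Algebra R R'] (z : Fin 8 → R) :
    gam (extend R' z) = (gam z).map (algebraMap R R') := by
  ext i j
  rcases i with i | i <;> rcases j with j | j <;> fin_cases i <;> fin_cases j <;>
    simp [gam, extend, altMatrix, altMatrixDual, Algebra.algebraMap_eq_smul_one]

lemma gamDual_extend {R' : Type*} [CommRing R'] [Algebra R R'] (z : Fin 8 → R) :
    gamDual (extend R' z) = (gamDual z).map (algebraMap R R') := by
  ext i j
  rw [gamDual, gamDual, Matrix.smul_apply, Matrix.map_apply, Matrix.smul_apply, smul_eq_mul,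
    smul_eq_mul, map_mul, map_ofNat]
  congr 1
  rcases i with i | i <;> rcases j with j | j <;> fin_cases i <;> fin_cases j <;>
    simp [extend, altMatrix, altMatrixDual, Algebra.algebraMap_eq_smul_one]

end

/-! ### The annihilator of a spinor -/

/-- The coordinates on `V_ℂ = W_ℂ ⊕ W_ℂ^*`. -/
def coordV : VC ≃ₗ[ℂ] (Fin 4 ⊕ Fin 4 → ℂ) :=
  (LinearEquiv.sumArrowLequivProdArrow (Fin 4) (Fin 4) ℂ ℂ).symm

lemma coordV_apply (v : VC) : coordV v = Sum.elim v.1 v.2 := rfl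

lemma contractLeft_e_mul (d : Module.Dual ℂ (Fin 4 → ℂ)) (i : Fin 4)
    (x : ExteriorAlgebra ℂ (Fin 4 → ℂ)) :
    CliffordAlgebra.contractLeft (Q := (0 : QuadraticForm ℂ (Fin 4 → ℂ))) d (e i * x)
      = d (Pi.single i 1) • x
        - e i * CliffordAlgebra.contractLeft (Q := (0 : QuadraticForm ℂ (Fin 4 → ℂ))) d x :=
  CliffordAlgebra.contractLeft_ι_mul (Q := (0 : QuadraticForm ℂ (Fin 4 → ℂ))) (d := d) _ _

lemma contractLeft_e (d : Module.Dual ℂ (Fin 4 → ℂ)) (i : Fin 4) :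
    CliffordAlgebra.contractLeft (Q := (0 : QuadraticForm ℂ (Fin 4 → ℂ))) d (e i)
      = d (Pi.single i 1) • 1 :=
  (CliffordAlgebra.contractLeft_ι (Q := (0 : QuadraticForm ℂ (Fin 4 → ℂ))) (d := d) _).trans
    (Algebra.algebraMap_eq_smul_one _)

/-- The element of `⋀^odd W_ℂ` with the given coordinates. -/
def oddSpinor (y : Fin 4 ⊕ Fin 4 → ℂ) : ExteriorAlgebra ℂ (Fin 4 → ℂ) :=
  y (.inl 0) • e 0 + y (.inl 1) • e 1 + y (.inl 2) • e 2 + y (.inl 3) • e 3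
    + y (.inr 0) • (e 1 * e 2 * e 3) - y (.inr 1) • (e 0 * e 2 * e 3)
    + y (.inr 2) • (e 0 * e 1 * e 3) - y (.inr 3) • (e 0 * e 1 * e 2)

/-- This turns the annihilator of a spinor into the kernel of an explicit matrix. The signs in
`oddSpinor` and the blocks of `gam` are fixed by this identity. -/
lemma cliffordAct_spinor (v : VC) (z : Fin 8 → ℂ) :
    cliffordAct v (spinor z) = oddSpinor ((gam z).mulVec (coordV v)) := by
  have hv : ExteriorAlgebra.ι ℂ v.1 = v.1 0 • e 0 + v.1 1 • e 1 + v.1 2 • e 2 + v.1 3 • e 3 := by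
    simp only [e, ← map_smul, ← map_add]
    congr 1
    ext i; fin_cases i <;> simp
  have sq : ∀ i, e i * e i = 0 := fun i => ExteriorAlgebra.ι_sq_zero _
  have sq' : ∀ i x, e i * (e i * x) = 0 := fun i x => by rw [← mul_assoc, sq, zero_mul]
  -- The condition `j < i` orients anticommutation towards increasing indices, so that rewriting
  -- sorts every monomial and terminates.
  have an : ∀ i j, j < i → e i * e j = - (e j * e i) := fun i j _ => e_mul_e i j
  have an' : ∀ i j x, j < i → e i * (e j * x) = - (e j * (e i * x)) := fun i j x _ => by
    rw [← mul_assoc, e_mul_e i j, neg_mul, mul_assoc]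
  have hone : ∀ d : Module.Dual ℂ (Fin 4 → ℂ),
      CliffordAlgebra.contractLeft (Q := (0 : QuadraticForm ℂ (Fin 4 → ℂ))) d 1 = 0 :=
    fun d => CliffordAlgebra.contractLeft_one (Q := (0 : QuadraticForm ℂ (Fin 4 → ℂ))) (d := d)
  unfold cliffordAct spinor oddSpinor
  rw [hv, gam, coordV_apply, Matrix.fromBlocks_mulVec]
  simp only [Sum.elim_inl, Sum.elim_inr, Pi.add_apply, Matrix.smul_mulVec, Matrix.one_mulVec,
    Pi.smul_apply, Matrix.neg_mulVec, Pi.neg_apply, Matrix.mulVec, dotProduct,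
    Fin.sum_univ_four, smul_eq_mul, Sum.elim_comp_inl, Sum.elim_comp_inr]
  simp only [mul_assoc, map_add, map_sub, map_smul, contractLeft_e_mul, contractLeft_e, hone]
  simp [mul_add, add_mul, mul_sub, sq, sq', an, an', altMatrix, altMatrixDual]
  module

/-- Contractions with the dual basis read off the coordinates: triple contractions give the cubic
ones, and once these vanish single contractions give the linear ones. -/
lemma oddSpinor_eq_zero {y : Fin 4 ⊕ Fin 4 → ℂ} (hy : oddSpinor y = 0) : y = 0 := by
  let d : Fin 4 → Module.Dual ℂ (Fin 4 → ℂ) := fun i => LinearMap.proj i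
  let D : Fin 4 → ExteriorAlgebra ℂ (Fin 4 → ℂ) →ₗ[ℂ] ExteriorAlgebra ℂ (Fin 4 → ℂ) := fun i =>
    CliffordAlgebra.contractLeft (Q := (0 : QuadraticForm ℂ (Fin 4 → ℂ))) (d i)
  have D1 : ∀ i, D i 1 = 0 := fun i =>
    CliffordAlgebra.contractLeft_one (Q := (0 : QuadraticForm ℂ (Fin 4 → ℂ))) (d := d i)
  have De : ∀ i j, D i (e j) = (if i = j then (1 : ℂ) else 0) • 1 := fun i j => by
    simp only [D, contractLeft_e, d, LinearMap.proj_apply, Pi.single_apply]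
  have Dm : ∀ i j x, D i (e j * x) = (if i = j then (1 : ℂ) else 0) • x - e j * D i x :=
    fun i j x => by
      simp only [D, contractLeft_e_mul, d, LinearMap.proj_apply, Pi.single_apply]
  have one : ∀ c : ℂ, c • (1 : ExteriorAlgebra ℂ (Fin 4 → ℂ)) = 0 → c = 0 := fun c hc =>
    (smul_eq_zero.1 hc).resolve_right one_ne_zero
  have three : ∀ i j k, D i (D j (D k (oddSpinor y))) = 0 := fun i j k => by
    rw [hy, map_zero, map_zero, map_zero]
  have r0 : y (.inr 0) = 0 := one _ (by
    simpa [oddSpinor, mul_assoc, Dm, De, D1] using three 3 2 1)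
  have r1 : y (.inr 1) = 0 := one _ (by
    simpa [oddSpinor, mul_assoc, Dm, De, D1] using three 3 2 0)
  have r2 : y (.inr 2) = 0 := one _ (by
    simpa [oddSpinor, mul_assoc, Dm, De, D1] using three 3 1 0)
  have r3 : y (.inr 3) = 0 := one _ (by
    simpa [oddSpinor, mul_assoc, Dm, De, D1] using three 2 1 0)
  have single : ∀ i, D i (oddSpinor y) = 0 := fun i => by rw [hy, map_zero]
  have l : ∀ i, y (.inl i) = 0 := fun i => one _ (by
    have := single i
    fin_cases i <;> simpa [oddSpinor, De, r0, r1, r2, r3] using this)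
  ext i
  rcases i with i | i
  · exact l i
  · fin_cases i <;> assumption

lemma mem_isotropicSpace (l : Projectivization ℂ (Fin 8 → ℂ)) (v : VC) :
    v ∈ isotropicSpace l ↔ (gam l.rep).mulVec (coordV v) = 0 := by
  change cliffordAct v (spinor l.rep) = 0 ↔ _
  rw [cliffordAct_spinor]
  refine ⟨oddSpinor_eq_zero, fun h => ?_⟩
  rw [h]
  simp [oddSpinor]

end KugaSatakeSpinor

end

noncomputable section

namespace KugaSatakeSpinor

/-! ### Algebras generated by anticommuting elements -/

section

variable {K C : Type*} [Field K] [Ring C] [Algebra K C] {ι : Type*}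

/-- The spans of the products of an even, respectively odd, number of elements of a list. -/
def paritySpan (K : Type*) {C : Type*} [Field K] [Ring C] [Algebra K C] {ι : Type*} (x : ι → C) :
    List ι → Submodule K C × Submodule K C
  | [] => (Submodule.span K {1}, ⊥)
  | i :: L => ((paritySpan K x L).1 ⊔ (paritySpan K x L).2.map (LinearMap.mulLeft K (x i)),
      (paritySpan K x L).2 ⊔ (paritySpan K x L).1.map (LinearMap.mulLeft K (x i)))

lemma mem_paritySpan_cons_fst (x : ι → C) (i : ι) (L : List ι) (y : C) :
    y ∈ (paritySpan K x (i :: L)).1 ↔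
      ∃ a ∈ (paritySpan K x L).1, ∃ b ∈ (paritySpan K x L).2, a + x i * b = y := by
  simp [paritySpan, Submodule.mem_sup]

lemma mem_paritySpan_cons_snd (x : ι → C) (i : ι) (L : List ι) (y : C) :
    y ∈ (paritySpan K x (i :: L)).2 ↔
      ∃ a ∈ (paritySpan K x L).2, ∃ b ∈ (paritySpan K x L).1, a + x i * b = y := by
  simp [paritySpan, Submodule.mem_sup]

lemma one_mem_paritySpan (x : ι → C) (L : List ι) : (1 : C) ∈ (paritySpan K x L).1 := by
  induction L with
  | nil => exact Submodule.mem_span_singleton_self 1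
  | cons i L ih => exact Submodule.mem_sup_left ih

variable {x : ι → C} {c : ι → K} (hanti : ∀ i j, i ≠ j → x i * x j = -(x j * x i))
  (hsq : ∀ i, x i * x i = c i • 1)

include hanti in
-- A generator outside the list changes sign with every factor it passes, so only the parity of the
-- number of factors matters.
lemma mul_comm_of_mem_paritySpan {j : ι} {L : List ι} (hj : j ∉ L) :
    (∀ a ∈ (paritySpan K x L).1, x j * a = a * x j) ∧
      ∀ a ∈ (paritySpan K x L).2, x j * a = -(a * x j) := by
  induction L with
  | nil =>
    constructor
    · intro a ha
      obtain ⟨r, rfl⟩ := Submodule.mem_span_singleton.1 ha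
      simp
    · intro a ha
      rw [(Submodule.mem_bot K).1 ha]
      simp
  | cons i L ih =>
    simp only [List.mem_cons, not_or] at hj
    obtain ⟨h1, h2⟩ := ih hj.2
    constructor
    · intro y hy
      obtain ⟨a, ha, b, hb, rfl⟩ := (mem_paritySpan_cons_fst x i L y).1 hy
      rw [mul_add, add_mul, h1 a ha, ← mul_assoc, hanti j i hj.1, neg_mul, mul_assoc, h2 b hb,
        mul_neg, neg_neg, mul_assoc]
    · intro y hy
      obtain ⟨a, ha, b, hb, rfl⟩ := (mem_paritySpan_cons_snd x i L y).1 hy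
      rw [mul_add, add_mul, h2 a ha, ← mul_assoc, hanti j i hj.1, neg_mul, mul_assoc, h1 b hb,
        neg_add, mul_assoc]

include hanti hsq in
-- A generator in the list is moved past the others until it meets its own copy, where its square is
-- a scalar.
lemma mul_mem_paritySpan {j : ι} {L : List ι} (hj : j ∈ L) :
    (∀ a ∈ (paritySpan K x L).1, x j * a ∈ (paritySpan K x L).2) ∧
      ∀ a ∈ (paritySpan K x L).2, x j * a ∈ (paritySpan K x L).1 := by
  induction L with
  | nil => simp at hj
  | cons i L ih =>
    by_cases hij : j = i
    · subst hij
      constructor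
      · intro y hy
        obtain ⟨a, ha, b, hb, rfl⟩ := (mem_paritySpan_cons_fst x j L y).1 hy
        refine (mem_paritySpan_cons_snd x j L _).2
          ⟨c j • b, Submodule.smul_mem _ _ hb, a, ha, ?_⟩
        rw [mul_add, ← mul_assoc, hsq, smul_mul_assoc, one_mul, add_comm]
      · intro y hy
        obtain ⟨a, ha, b, hb, rfl⟩ := (mem_paritySpan_cons_snd x j L y).1 hy
        refine (mem_paritySpan_cons_fst x j L _).2
          ⟨c j • b, Submodule.smul_mem _ _ hb, a, ha, ?_⟩
        rw [mul_add, ← mul_assoc, hsq, smul_mul_assoc, one_mul, add_comm]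
    · obtain ⟨h1, h2⟩ := ih ((List.mem_cons.1 hj).resolve_left hij)
      constructor
      · intro y hy
        obtain ⟨a, ha, b, hb, rfl⟩ := (mem_paritySpan_cons_fst x i L y).1 hy
        refine (mem_paritySpan_cons_snd x i L _).2 ⟨x j * a, h1 a ha, -(x j * b),
          Submodule.neg_mem _ (h2 b hb), ?_⟩
        rw [mul_add, ← mul_assoc, hanti j i hij, mul_neg, neg_mul, mul_assoc]
      · intro y hy
        obtain ⟨a, ha, b, hb, rfl⟩ := (mem_paritySpan_cons_snd x i L y).1 hy
        refine (mem_paritySpan_cons_fst x i L _).2 ⟨x j * a, h2 a ha, -(x j * b),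
          Submodule.neg_mem _ (h1 b hb), ?_⟩
        rw [mul_add, ← mul_assoc, hanti j i hij, mul_neg, neg_mul, mul_assoc]

variable {A : Type*} [Ring A] [Nontrivial A] [Algebra K A] (T : C →ₐ[K] A)

include hanti hsq in
/-- A homomorphism to a nonzero algebra is injective on the even and the odd part. -/
lemma eq_zero_of_mem_paritySpan (h2 : (2 : K) ≠ 0) (hc : ∀ i, c i ≠ 0) {L : List ι}
    (hL : L.Nodup) :
    (∀ a ∈ (paritySpan K x L).1, T a = 0 → a = 0) ∧
      ∀ a ∈ (paritySpan K x L).2, T a = 0 → a = 0 := by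
  have scal : ∀ i b, T (x i * x i * b + x i * x i * b) = 0 → T b = 0 := fun i b hb => by
    rw [hsq, smul_mul_assoc, one_mul, ← add_smul, map_smul, smul_eq_zero, ← two_mul] at hb
    exact hb.resolve_left (mul_ne_zero h2 (hc i))
  induction L with
  | nil =>
    constructor
    · intro a ha h0
      obtain ⟨r, rfl⟩ := Submodule.mem_span_singleton.1 ha
      rw [map_smul, map_one, smul_eq_zero] at h0
      rw [h0.resolve_right one_ne_zero, zero_smul]
    · intro a ha _
      exact (Submodule.mem_bot K).1 ha
  | cons i L ih =>
    obtain ⟨hi, hL⟩ := List.nodup_cons.1 hL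
    obtain ⟨ih1, ih2⟩ := ih hL
    obtain ⟨c1, c2⟩ := mul_comm_of_mem_paritySpan (K := K) hanti hi
    constructor
    · intro y hy h0
      obtain ⟨a, ha, b, hb, rfl⟩ := (mem_paritySpan_cons_fst x i L y).1 hy
      -- In y = a + xᵢb, with a even and b odd in the remaining generators, a commutes and b
      -- anticommutes with xᵢ. The commutator of xᵢ with y thus isolates 2xᵢ²b, a nonzero multiple
      -- of b, and `T` kills it along with y. For odd y the anticommutator plays this role.
      have key : x i * (a + x i * b) - (a + x i * b) * x i
          = x i * x i * b + x i * x i * b := by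
        rw [mul_add, add_mul, c1 a ha, mul_assoc (x i) b, ← neg_eq_iff_eq_neg.2 (c2 b hb)]
        noncomm_ring
      have hb0 : b = 0 := ih2 b hb (scal i b (by rw [← key, map_sub, map_mul, map_mul, h0]; simp))
      subst hb0
      simp only [mul_zero, add_zero] at h0 ⊢
      exact ih1 a ha h0
    · intro y hy h0
      obtain ⟨a, ha, b, hb, rfl⟩ := (mem_paritySpan_cons_snd x i L y).1 hy
      have key : x i * (a + x i * b) + (a + x i * b) * x i
          = x i * x i * b + x i * x i * b := by
        rw [mul_add, add_mul, c2 a ha, mul_assoc (x i) b, ← c1 b hb]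
        noncomm_ring
      have hb0 : b = 0 := ih1 b hb (scal i b (by rw [← key, map_add, map_mul, map_mul, h0]; simp))
      subst hb0
      simp only [mul_zero, add_zero] at h0 ⊢
      exact ih2 a ha h0

lemma finiteDimensional_paritySpan (x : ι → C) (L : List ι) :
    FiniteDimensional K (paritySpan K x L).1 ∧ FiniteDimensional K (paritySpan K x L).2 := by
  induction L with
  | nil => exact ⟨inferInstanceAs (FiniteDimensional K (Submodule.span K {(1 : C)})),
      inferInstanceAs (FiniteDimensional K (⊥ : Submodule K C))⟩
  | cons i L ih =>
    obtain ⟨h1, h2⟩ := ih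
    exact ⟨Submodule.finiteDimensional_sup _ _, Submodule.finiteDimensional_sup _ _⟩

include hanti hsq in
-- Left multiplication by xᵢ is injective because xᵢ² is a nonzero scalar, and both sums are direct:
-- an element of an intersection would have to commute and anticommute with xᵢ.
lemma finrank_paritySpan_cons [Nontrivial C] (h2 : (2 : K) ≠ 0) (hc : ∀ i, c i ≠ 0) {i : ι}
    {L : List ι} (hL : (i :: L).Nodup) :
    Module.finrank K (paritySpan K x (i :: L)).1 =
        Module.finrank K (paritySpan K x L).1 + Module.finrank K (paritySpan K x L).2 ∧
      Module.finrank K (paritySpan K x (i :: L)).2 =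
        Module.finrank K (paritySpan K x L).2 + Module.finrank K (paritySpan K x L).1 := by
  obtain ⟨f1, f2⟩ := finiteDimensional_paritySpan (K := K) x L
  obtain ⟨hi, hL'⟩ := List.nodup_cons.1 hL
  obtain ⟨c1, c2⟩ := mul_comm_of_mem_paritySpan (K := K) hanti hi
  have inj : Function.Injective (LinearMap.mulLeft K (x i)) := by
    intro a b hab
    have := congrArg (fun y => x i * y) hab
    simp only [LinearMap.mulLeft_apply, ← mul_assoc, hsq, smul_mul_assoc, one_mul] at this
    exact smul_right_injective C (hc i) this
  have scal : ∀ b, x i * x i * b + x i * x i * b = 0 → b = 0 := fun b hb => by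
    rw [hsq, smul_mul_assoc, one_mul, ← add_smul, smul_eq_zero, ← two_mul] at hb
    exact hb.resolve_left (mul_ne_zero h2 (hc i))
  have d1 : Disjoint (paritySpan K x L).1
      ((paritySpan K x L).2.map (LinearMap.mulLeft K (x i))) := by
    rw [Submodule.disjoint_def]
    rintro _ ha ⟨b, hb, rfl⟩
    have hcomm := c1 _ ha
    simp only [LinearMap.mulLeft_apply] at hcomm ⊢
    rw [mul_assoc (x i) b, ← neg_eq_iff_eq_neg.2 (c2 b hb), mul_neg, ← mul_assoc,
      eq_neg_iff_add_eq_zero] at hcomm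
    rw [scal b hcomm, mul_zero]
  have d2 : Disjoint (paritySpan K x L).2
      ((paritySpan K x L).1.map (LinearMap.mulLeft K (x i))) := by
    rw [Submodule.disjoint_def]
    rintro _ ha ⟨b, hb, rfl⟩
    have hcomm := c2 _ ha
    simp only [LinearMap.mulLeft_apply] at hcomm ⊢
    rw [mul_assoc (x i) b, ← c1 b hb, ← mul_assoc, eq_neg_iff_add_eq_zero] at hcomm
    rw [scal b hcomm, mul_zero]
  have r1 := Submodule.finrank_sup_add_finrank_inf_eq (paritySpan K x L).1
    ((paritySpan K x L).2.map (LinearMap.mulLeft K (x i)))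
  have r2 := Submodule.finrank_sup_add_finrank_inf_eq (paritySpan K x L).2
    ((paritySpan K x L).1.map (LinearMap.mulLeft K (x i)))
  rw [d1.eq_bot, finrank_bot, add_zero,
    ← (Submodule.equivMapOfInjective _ inj _).finrank_eq] at r1
  rw [d2.eq_bot, finrank_bot, add_zero,
    ← (Submodule.equivMapOfInjective _ inj _).finrank_eq] at r2
  exact ⟨r1, r2⟩

include hanti hsq in
-- The dimensions of the even and odd parts are (1, 0) for no generator and (1, 1) for one; each
-- further generator doubles both.
lemma finrank_paritySpan [Nontrivial C] (h2 : (2 : K) ≠ 0) (hc : ∀ i, c i ≠ 0) (i : ι)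
    {L : List ι} (hL : (i :: L).Nodup) :
    Module.finrank K (paritySpan K x (i :: L)).1 = 2 ^ L.length ∧
      Module.finrank K (paritySpan K x (i :: L)).2 = 2 ^ L.length := by
  induction L generalizing i with
  | nil =>
    have h := finrank_paritySpan_cons (K := K) hanti hsq h2 hc hL
    have e1 : Module.finrank K (paritySpan K x []).1 = 1 :=
      finrank_span_singleton (one_ne_zero : (1 : C) ≠ 0)
    have e2 : Module.finrank K (paritySpan K x []).2 = 0 := finrank_bot K C
    rw [h.1, h.2, e1, e2]
    simp
  | cons j L ih =>
    have h := finrank_paritySpan_cons (K := K) hanti hsq h2 hc hL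
    have h' := ih j (List.nodup_cons.1 hL).2
    rw [h.1, h.2, h'.1, h'.2, List.length_cons, pow_succ]
    constructor <;> ring

end

end KugaSatakeSpinor

end

noncomputable section

namespace KugaSatakeSpinor

/-! ### Criteria for complex tori and isogenies -/

/-- The hypotheses say that the real span of `b` maps isomorphically onto M / F, so the classes of
the `b i` form a real basis of it. -/
lemma isComplexTorus_periodLattice {M : Type*} [AddCommGroup M] [Module ℂ M] {ι : Type*}
    [Fintype ι] {g : ℕ} (hι : Fintype.card ι = 2 * g) (F : Submodule ℂ M) (b : ι → M)
    (h0 : ∀ a : ι → ℝ, ∑ i, (a i : ℂ) • b i ∈ F → a = 0)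
    (h1 : ∀ x : M, ∃ a : ι → ℝ, x - ∑ i, (a i : ℂ) • b i ∈ F) :
    IsComplexTorus g (periodLattice F (AddSubgroup.closure (Set.range b))) := by
  let f : (ι → ℝ) →ₗ[ℝ] M ⧸ F :=
    { toFun := fun a => F.mkQ (∑ i, (a i : ℂ) • b i)
      map_add' := fun a a' => by
        rw [← map_add, ← Finset.sum_add_distrib]
        simp only [Pi.add_apply, Complex.ofReal_add, add_smul]
      map_smul' := fun r a => by
        rw [RingHom.id_apply, ← Complex.coe_smul, ← map_smul, Finset.smul_sum]
        simp only [Pi.smul_apply, smul_eq_mul, Complex.ofReal_mul, mul_smul] }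
  have hf : Function.Bijective f := by
    constructor
    · rw [injective_iff_map_eq_zero]
      intro a ha
      exact h0 a ((Submodule.Quotient.mk_eq_zero F).1 ha)
    · intro y
      obtain ⟨x, rfl⟩ := F.mkQ_surjective y
      obtain ⟨a, ha⟩ := h1 x
      exact ⟨a, ((Submodule.Quotient.eq F).2 ha).symm⟩
  let B : Module.Basis ι ℝ (M ⧸ F) := Module.Basis.ofEquivFun (LinearEquiv.ofBijective f hf).symm
  have hB : ∀ i, B i = F.mkQ (b i) := by
    classical
    intro i
    rw [Module.Basis.coe_ofEquivFun, LinearEquiv.symm_symm]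
    change F.mkQ (∑ j, ((Pi.single i (1 : ℝ) : ι → ℝ) j : ℂ) • b j) = _
    congr 1
    rw [Finset.sum_eq_single i]
    · simp
    · intro j _ hj
      simp [Pi.single_eq_of_ne hj]
    · simp
  let eι : ι ≃ Fin (2 * g) := Fintype.equivFinOfCardEq hι
  refine ⟨?_, B.reindex eι, ?_⟩
  · have h := finrank_real_of_complex (M ⧸ F)
    rw [Module.finrank_eq_card_basis B, hι] at h
    omega
  · rw [Module.Basis.range_reindex, periodLattice, AddMonoidHom.map_closure, ← Set.range_comp]
    congr 2
    ext i
    exact hB i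

/-- `Φ` induces an isomorphism M / F ≅ (N / Z)ⁿ of universal covers carrying one lattice into the
other. Surjectivity is then clear, and the kernel consists of the classes of Φ⁻¹(Λ'ⁿ) modulo Λ, all
represented in the finite set `S`. -/
lemma isogenous_powLattice {M N : Type*} [AddCommGroup M] [Module ℂ M] [AddCommGroup N]
    [Module ℂ N] {n : ℕ} (Φ : M ≃ₗ[ℂ] (Fin n → N)) (F : Submodule ℂ M) (Z : Submodule ℂ N)
    (Λ : AddSubgroup M) (Λ' : AddSubgroup N) (hF : ∀ x, x ∈ F ↔ ∀ k, Φ x k ∈ Z)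
    (hΛ : ∀ x ∈ Λ, ∀ k, Φ x k ∈ Λ') {S : Set M} (hS : S.Finite)
    (hindex : ∀ y : Fin n → N, (∀ k, y k ∈ Λ') → ∃ s ∈ S, Φ.symm y - s ∈ Λ) :
    Isogenous (periodLattice F Λ) (powLattice n (periodLattice Z Λ')) := by
  let G : M →ₗ[ℂ] (Fin n → N ⧸ Z) := LinearMap.pi fun k => Z.mkQ ∘ₗ LinearMap.proj k ∘ₗ Φ.toLinearMap
  have hG : ∀ x k, G x k = Z.mkQ (Φ x k) := fun _ _ => rfl
  have hker : ∀ x, G x = 0 ↔ x ∈ F := fun x => by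
    rw [hF, funext_iff]
    refine forall_congr' fun k => ?_
    rw [hG]
    exact Submodule.Quotient.mk_eq_zero Z
  let F' : M ⧸ F →ₗ[ℂ] (Fin n → N ⧸ Z) := F.liftQ G fun x hx => (hker x).2 hx
  have hF' : ∀ x, F' (F.mkQ x) = G x := fun x => F.liftQ_apply G x
  have hF'inj : ∀ y, F' y = 0 → y = 0 := by
    intro y hy
    obtain ⟨x, rfl⟩ := F.mkQ_surjective y
    rw [hF', hker] at hy
    exact (Submodule.Quotient.mk_eq_zero F).2 hy
  have hle : periodLattice F Λ ≤ (powLattice n (periodLattice Z Λ')).comap F'.toAddMonoidHom := by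
    rintro _ ⟨x, hx, rfl⟩
    change F' (F.mkQ x) ∈ powLattice n (periodLattice Z Λ')
    rw [hF']
    exact fun k _ => ⟨Φ x k, hΛ x hx k, rfl⟩
  refine ⟨QuotientAddGroup.map _ _ F'.toAddMonoidHom hle, ⟨F', fun x => rfl⟩, ?_, ?_⟩
  · intro y
    obtain ⟨y, rfl⟩ := QuotientAddGroup.mk_surjective y
    choose z hz using fun k => Z.mkQ_surjective (y k)
    refine ⟨(F.mkQ (Φ.symm z) : M ⧸ F), ?_⟩
    change ((F' (F.mkQ (Φ.symm z)) : Fin n → N ⧸ Z) : _ ⧸ powLattice n (periodLattice Z Λ')) = _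
    congr 1
    rw [hF']
    ext k
    rw [hG, LinearEquiv.apply_symm_apply, hz]
  · refine Set.Finite.subset
      (hS.image fun s => ((F.mkQ s : M ⧸ F) : (M ⧸ F) ⧸ periodLattice F Λ)) ?_
    intro u hu
    obtain ⟨u, rfl⟩ := QuotientAddGroup.mk_surjective u
    have hu' : F' u ∈ powLattice n (periodLattice Z Λ') :=
      (QuotientAddGroup.eq_zero_iff _).1 hu
    choose y hy hyu using fun k => hu' k (Set.mem_univ k)
    have hu'' : u = F.mkQ (Φ.symm y) := by
      rw [← sub_eq_zero]
      apply hF'inj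
      rw [map_sub, hF', sub_eq_zero]
      ext k
      rw [hG, LinearEquiv.apply_symm_apply]
      exact (hyu k).symm
    obtain ⟨s, hs, hsy⟩ := hindex y hy
    refine ⟨s, hs, ?_⟩
    rw [hu'']
    refine (QuotientAddGroup.eq).2 ?_
    rw [neg_add_eq_sub, ← map_sub]
    exact ⟨_, hsy, rfl⟩

/-! ### Lattices given by integral coordinates -/

/-- A subgroup with integral coordinates which spans a complex vector space is spanned by a basis,
and it has finite index in the group of all vectors with integral coordinates. -/
lemma exists_basis_of_integral {M : Type*} [AddCommGroup M] [Module ℂ M] {κ : Type*} [Fintype κ]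
    (Φ : M ≃ₗ[ℂ] (κ → ℂ)) (Λ : AddSubgroup M)
    (hint : ∀ x ∈ Λ, ∃ n : κ → ℤ, Φ x = fun i => (n i : ℂ))
    (hspan : Submodule.span ℂ (Λ : Set M) = ⊤) :
    (∃ b : Module.Basis κ ℂ M, AddSubgroup.closure (Set.range b) = Λ) ∧
      ∃ S : Set M, S.Finite ∧ ∀ n : κ → ℤ, ∃ s ∈ S, Φ.symm (fun i => (n i : ℂ)) - s ∈ Λ := by
  classical
  let ψ : (κ → ℤ) →ₗ[ℤ] M :=
    { toFun := fun n => Φ.symm fun i => (n i : ℂ)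
      map_add' := fun n m => by
        rw [← map_add]
        congr 1
        ext i
        simp
      map_smul' := fun r n => by
        rw [← map_zsmul]
        congr 1
        ext i
        simp }
  let L : Submodule ℤ (κ → ℤ) := (AddSubgroup.toIntSubmodule Λ).comap ψ
  have hLΛ : L.map ψ = AddSubgroup.toIntSubmodule Λ := by
    refine le_antisymm (Submodule.map_comap_le _ _) fun x hx => ?_
    obtain ⟨n, hn⟩ := hint x hx
    have hψ : ψ n = x := by
      change Φ.symm _ = x
      rw [← hn, LinearEquiv.symm_apply_apply]
    exact ⟨n, show ψ n ∈ _ by rw [hψ]; exact hx, hψ⟩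
  obtain ⟨n, B⟩ := Submodule.basisOfPid (Pi.basisFun ℤ κ) L
  let b : Fin n → M := fun i => ψ (B i)
  have hb : Submodule.span ℤ (Set.range b) = AddSubgroup.toIntSubmodule Λ := by
    rw [← hLΛ, ← L.map_subtype_top, ← B.span_eq, Submodule.map_span, Submodule.map_span,
      ← Set.range_comp, ← Set.range_comp]
    rfl
  have hb' : AddSubgroup.closure (Set.range b) = Λ := by
    rw [← Submodule.span_int_eq_addSubgroupClosure, hb]
    rfl
  have hbtop : ⊤ ≤ Submodule.span ℂ (Set.range b) := by
    rw [← hspan, Submodule.span_le]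
    intro x hx
    rw [← hb'] at hx
    exact (AddSubgroup.closure_le (Submodule.span ℂ (Set.range b)).toAddSubgroup).2
      Submodule.subset_span hx
  have hM : Module.finrank ℂ M = Fintype.card κ := by
    rw [Φ.finrank_eq, Module.finrank_fintype_fun_eq_card]
  have hrank : Module.finrank ℤ L = n := by
    rw [Module.finrank_eq_card_basis B, Fintype.card_fin]
  -- A subgroup of ℤ^κ has rank at most |κ|; a ℤ-basis of it also spans `M` over ℂ, which forces the
  -- reverse inequality.
  have hn : n = Fintype.card κ := by
    refine le_antisymm ?_ ?_
    · rw [← hrank, ← Module.finrank_fintype_fun_eq_card ℤ]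
      exact Submodule.finrank_le L
    · rw [← hM, ← finrank_top ℂ M, ← top_le_iff.1 hbtop]
      exact (finrank_range_le_card (R := ℂ) b).trans_eq (Fintype.card_fin n)
  constructor
  · let B' : Module.Basis (Fin n) ℂ M :=
      basisOfTopLeSpanOfCardEqFinrank b hbtop (by rw [hM, Fintype.card_fin, hn])
    refine ⟨B'.reindex (Fintype.equivFinOfCardEq hn.symm).symm, ?_⟩
    rw [Module.Basis.range_reindex, coe_basisOfTopLeSpanOfCardEqFinrank, hb']
  · have hfin : Finite ((κ → ℤ) ⧸ L) := Submodule.finiteQuotientOfFreeOfRankEq L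
      (by rw [hrank, hn, Module.finrank_fintype_fun_eq_card])
    refine ⟨Set.range fun q : (κ → ℤ) ⧸ L => ψ q.out, Set.finite_range _, fun m => ?_⟩
    refine ⟨_, ⟨L.mkQ m, rfl⟩, ?_⟩
    have hm : m - (L.mkQ m).out ∈ L := by
      rw [← Submodule.Quotient.eq]
      exact (Quotient.out_eq _).symm
    have hm' : ψ (m - (L.mkQ m).out) ∈ Λ := hm
    rw [map_sub] at hm'
    exact hm'

end KugaSatakeSpinor

end

noncomputable section

namespace KugaSatakeSpinor

/-! ### Cyclic vectors for an integral complex multiplication -/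

/-- `J` makes V a complex vector space of dimension m. A family spanning V over ℝ spans it over ℂ,
so it contains a complex basis, which has m members. -/
lemma exists_span_union_complexStructure {V : Type*} [AddCommGroup V] [Module ℝ V]
    [Module.Finite ℝ V] {m : ℕ} (hV : Module.finrank ℝ V = 2 * m) (J : V →ₗ[ℝ] V)
    (hJ : J * J = -1) {κ : Type*} (b : κ → V) (hb : Submodule.span ℝ (Set.range b) = ⊤) :
    ∃ k : Fin m → κ,
      Submodule.span ℝ (Set.range (fun i => b (k i)) ∪ Set.range fun i => J (b (k i))) = ⊤ := by
  let _ : Module ℂ V := Module.compHom V (Complex.liftAux J hJ).toRingHom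
  have hsmul : ∀ (z : ℂ) (v : V), z • v = z.re • v + z.im • J v := fun z v => by
    change (Complex.liftAux J hJ z) v = _
    rw [Complex.liftAux_apply]
    rfl
  have : IsScalarTower ℝ ℂ V := ⟨fun r z v => by
    rw [hsmul, hsmul, Complex.smul_re, Complex.smul_im, smul_add, smul_eq_mul, smul_eq_mul,
      mul_smul, mul_smul]⟩
  have : Module.Finite ℂ V := Module.Finite.of_restrictScalars_finite ℝ ℂ V
  obtain ⟨κ', a, -, hspan, hli⟩ := exists_linearIndependent' ℂ b
  have := hli.finite
  have := Fintype.ofFinite κ'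
  have htop : Submodule.span ℂ (Set.range (b ∘ a)) = ⊤ := by
    rw [hspan, eq_top_iff]
    intro v _
    have hv : v ∈ Submodule.span ℝ (Set.range b) := hb ▸ Submodule.mem_top
    exact Submodule.span_subset_span ℝ ℂ _ hv
  have hcard : Fintype.card κ' = m := by
    have h1 := Module.finrank_eq_card_basis (Module.Basis.mk hli htop.ge)
    have h2 := Module.finrank_mul_finrank ℝ ℂ V
    rw [Complex.finrank_real_complex, hV, h1] at h2
    omega
  let eq := Fintype.equivFinOfCardEq hcard
  refine ⟨a ∘ eq.symm, eq_top_iff.2 fun v _ => ?_⟩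
  have hv : v ∈ Submodule.span ℂ (Set.range (b ∘ a)) := htop ▸ Submodule.mem_top
  induction hv using Submodule.span_induction with
  | mem x hx =>
    obtain ⟨i, rfl⟩ := hx
    exact Submodule.subset_span (Or.inl ⟨eq i, by simp⟩)
  | zero => exact Submodule.zero_mem _
  | add x y _ _ hx hy => exact Submodule.add_mem _ (hx trivial) (hy trivial)
  | smul z x _ hx =>
    rw [hsmul]
    refine Submodule.add_mem _ (Submodule.smul_mem _ _ (hx trivial)) (Submodule.smul_mem _ _ ?_)
    have hx' := Submodule.mem_map_of_mem (f := J) (hx trivial)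
    rw [Submodule.map_span] at hx'
    refine Submodule.span_le.2 ?_ hx'
    rintro _ ⟨_, ⟨i, rfl⟩ | ⟨i, rfl⟩, rfl⟩
    · exact Submodule.subset_span (Or.inr ⟨i, rfl⟩)
    · have : J (J (b ((a ∘ eq.symm) i))) = -b ((a ∘ eq.symm) i) := LinearMap.congr_fun hJ _
      rw [this]
      exact Submodule.neg_mem _ (Submodule.subset_span (Or.inl ⟨i, rfl⟩))

/-- If `J` is an integral matrix whose square is a negative scalar, then half of the columns of
matrices `X` and `X * J` are enough to detect that `X = 0`. -/
lemma exists_columns_detecting_zero {n : Type*} [Fintype n] [DecidableEq n] {m : ℕ}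
    (hn : Fintype.card n = 2 * m) (J : Matrix n n ℤ) {N : ℤ} (hN : 0 < N)
    (hJ : J * J = -(N • (1 : Matrix n n ℤ))) :
    ∃ k : Fin m → n, ∀ X : Matrix n n ℂ, (∀ i, X.mulVec (Pi.single (k i) 1) = 0) →
      (∀ i, (X * J.map (algebraMap ℤ ℂ)).mulVec (Pi.single (k i) 1) = 0) → X = 0 := by
  have hN' : (0 : ℝ) < N := by exact_mod_cast hN
  have hJR : J.map (algebraMap ℤ ℝ) * J.map (algebraMap ℤ ℝ) = -((N : ℝ) • 1) := by
    rw [← Matrix.map_mul, hJ]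
    ext i j
    rw [Matrix.map_apply, Matrix.neg_apply, Matrix.neg_apply, Matrix.smul_apply,
      Matrix.smul_apply, Matrix.one_apply, Matrix.one_apply]
    split_ifs <;> simp
  -- Dividing by √N turns J into a genuine complex structure on ℝⁿ and does not change which vectors
  -- span.
  let J' : Matrix n n ℝ := (Real.sqrt N)⁻¹ • J.map (algebraMap ℤ ℝ)
  have hJ' : J' * J' = -1 := by
    simp only [J', Matrix.smul_mul, Matrix.mul_smul, hJR, smul_neg, smul_smul]
    rw [← mul_assoc, ← mul_inv, Real.mul_self_sqrt hN'.le, inv_mul_cancel₀ hN'.ne', one_smul]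
  obtain ⟨k, hk⟩ := exists_span_union_complexStructure (V := n → ℝ) (m := m)
    (by rw [Module.finrank_fintype_fun_eq_card, hn]) (Matrix.toLin' J')
    (by
      rw [Module.End.mul_eq_comp, ← Matrix.toLin'_mul, hJ', map_neg, Matrix.toLin'_one]
      rfl)
    (fun i => (Pi.single i 1 : n → ℝ)) (by
      rw [← (Pi.basisFun ℝ n).span_eq]
      congr 2
      funext i
      rw [Pi.basisFun_apply])
  refine ⟨k, fun X hX hXJ => ?_⟩
  let Y : (n → ℝ) →ₗ[ℝ] (n → ℂ) :=
    (X.mulVecLin.restrictScalars ℝ).comp (Complex.ofRealCLM.toLinearMap.compLeft n)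
  have hY : ∀ v, Y v = X.mulVec fun i => (v i : ℂ) := fun _ => rfl
  have hsingle : ∀ i : n, (fun j => ((Pi.single i 1 : n → ℝ) j : ℂ)) = Pi.single i 1 := fun i => by
    ext j
    simp only [Pi.single_apply]
    split_ifs <;> simp
  have key : (⊤ : Submodule ℝ (n → ℝ)) ≤ LinearMap.ker Y := by
    rw [← hk, Submodule.span_le]
    rintro _ (⟨i, rfl⟩ | ⟨i, rfl⟩)
    · change Y _ = 0
      rw [hY, hsingle, hX i]
    · have e : (fun j => ((Matrix.toLin' J' (Pi.single (k i) 1) j : ℝ) : ℂ))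
          = ((Real.sqrt N : ℂ))⁻¹ • (J.map (algebraMap ℤ ℂ)).mulVec (Pi.single (k i) 1) := by
        ext j
        simp [J']
      change Y _ = 0
      rw [hY, e, Matrix.mulVec_smul, Matrix.mulVec_mulVec, hXJ i, smul_zero]
  ext i j
  have h : Y (Pi.single j 1) = 0 := key trivial
  rw [hY, hsingle] at h
  simpa using congrFun h i

end KugaSatakeSpinor

end

noncomputable section

namespace KugaSatakeSpinor

/-! ### The even Clifford algebra of a quadratic form with an orthogonal basis -/

section

variable {K M : Type*} [Field K] [AddCommGroup M] [Module K M] (Q : QuadraticForm K M)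

lemma paritySpan_le_evenOdd {ι : Type*} (b : ι → M) (L : List ι) :
    (paritySpan K (fun i => CliffordAlgebra.ι Q (b i)) L).1 ≤ CliffordAlgebra.evenOdd Q 0 ∧
      (paritySpan K (fun i => CliffordAlgebra.ι Q (b i)) L).2 ≤ CliffordAlgebra.evenOdd Q 1 := by
  induction L with
  | nil =>
    refine ⟨?_, bot_le⟩
    rw [paritySpan, Submodule.span_singleton_le_iff_mem]
    exact SetLike.GradedOne.one_mem
  | cons i L ih =>
    obtain ⟨h1, h2⟩ := ih
    refine ⟨sup_le h1 ?_, sup_le h2 ?_⟩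
    · rintro _ ⟨y, hy, rfl⟩
      have := SetLike.mul_mem_graded (A := CliffordAlgebra.evenOdd Q)
        (CliffordAlgebra.ι_mem_evenOdd_one Q (b i)) (h2 hy)
      rwa [show (1 + 1 : ZMod 2) = 0 by decide] at this
    · rintro _ ⟨y, hy, rfl⟩
      have := SetLike.mul_mem_graded (A := CliffordAlgebra.evenOdd Q)
        (CliffordAlgebra.ι_mem_evenOdd_one Q (b i)) (h1 hy)
      rwa [add_zero] at this

variable {n : ℕ} (b : Module.Basis (Fin n) K M)
  (hb : ∀ i j, i ≠ j → QuadraticMap.IsOrtho Q (b i) (b j))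

include hb in
lemma ι_basis_anticomm (i j : Fin n) (hij : i ≠ j) :
    CliffordAlgebra.ι Q (b i) * CliffordAlgebra.ι Q (b j)
      = -(CliffordAlgebra.ι Q (b j) * CliffordAlgebra.ι Q (b i)) :=
  eq_neg_of_add_eq_zero_left (CliffordAlgebra.ι_mul_ι_add_swap_of_isOrtho (hb i j hij))

lemma ι_sq_smul (m : M) :
    CliffordAlgebra.ι Q m * CliffordAlgebra.ι Q m = Q m • (1 : CliffordAlgebra Q) := by
  rw [CliffordAlgebra.ι_sq_scalar, Algebra.algebraMap_eq_smul_one]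

include hb in
-- As the list contains the whole basis, multiplication by any vector interchanges the even and odd
-- spans; the even span contains 1, so it contains all even products.
lemma even_eq_paritySpan :
    Subalgebra.toSubmodule (CliffordAlgebra.even Q) =
      (paritySpan K (fun i => CliffordAlgebra.ι Q (b i)) (List.finRange n)).1 := by
  rw [CliffordAlgebra.even_toSubmodule]
  refine le_antisymm ?_ (paritySpan_le_evenOdd Q b _).1
  have hmul : ∀ i, _ := fun i => mul_mem_paritySpan (K := K)
    (x := fun i => CliffordAlgebra.ι Q (b i)) (ι_basis_anticomm Q b hb)
    (fun i => ι_sq_smul Q (b i)) (List.mem_finRange i)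
  intro x hx
  induction x, hx using CliffordAlgebra.even_induction with
  | algebraMap r =>
    rw [Algebra.algebraMap_eq_smul_one]
    exact Submodule.smul_mem _ _ (one_mem_paritySpan _ _)
  | add x y _ _ hx hy => exact Submodule.add_mem _ hx hy
  | ι_mul_ι_mul m₁ m₂ x _ hx =>
    have h2 : CliffordAlgebra.ι Q m₂ * x ∈
        (paritySpan K (fun i => CliffordAlgebra.ι Q (b i)) (List.finRange n)).2 := by
      rw [← b.sum_repr m₂, map_sum, Finset.sum_mul]
      refine Submodule.sum_mem _ fun i _ => ?_
      rw [map_smul, smul_mul_assoc]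
      exact Submodule.smul_mem _ _ ((hmul i).1 _ hx)
    rw [mul_assoc, ← b.sum_repr m₁, map_sum, Finset.sum_mul]
    refine Submodule.sum_mem _ fun i _ => ?_
    rw [map_smul, smul_mul_assoc]
    exact Submodule.smul_mem _ _ ((hmul i).2 _ h2)

include hb in
lemma eq_zero_of_mem_even [Invertible (2 : K)] (hQ : ∀ i, Q (b i) ≠ 0) {A : Type*} [Ring A]
    [Nontrivial A] [Algebra K A] (T : CliffordAlgebra Q →ₐ[K] A) {a : CliffordAlgebra Q}
    (ha : a ∈ CliffordAlgebra.even Q) (h0 : T a = 0) : a = 0 := by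
  rw [← Subalgebra.mem_toSubmodule, even_eq_paritySpan Q b hb] at ha
  exact (eq_zero_of_mem_paritySpan (ι_basis_anticomm Q b hb) (fun i => ι_sq_smul Q (b i)) T
    (Invertible.ne_zero 2) hQ (List.nodup_finRange n)).1 a ha h0

end

lemma finrank_even {K M : Type*} [Field K] [Invertible (2 : K)] [AddCommGroup M] [Module K M]
    (Q : QuadraticForm K M) {n : ℕ} (b : Module.Basis (Fin (n + 1)) K M)
    (hb : ∀ i j, i ≠ j → QuadraticMap.IsOrtho Q (b i) (b j)) (hQ : ∀ i, Q (b i) ≠ 0) :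
    Module.finrank K (CliffordAlgebra.even Q) = 2 ^ n := by
  have h := even_eq_paritySpan Q b hb
  rw [List.finRange_succ] at h
  change Module.finrank K (Subalgebra.toSubmodule (CliffordAlgebra.even Q)) = _
  have hnd := List.nodup_finRange (n + 1)
  rw [List.finRange_succ] at hnd
  rw [h, (finrank_paritySpan (ι_basis_anticomm Q b hb) (fun i => ι_sq_smul Q (b i))
    (Invertible.ne_zero 2) hQ 0 hnd).1]
  simp

/-! ### The orthogonal complement of `h, s` -/

section

variable {h s : Fin 8 → ℤ}

/-- A multiple of the orthogonal projection to `H ⊗ R`. -/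
def orthProj (R : Type*) [CommRing R] (h s : Fin 8 → ℤ) (hperp : spinForm ℤ h s = 0) :
    (Fin 8 → R) →ₗ[R] orthLattice R h s where
  toFun x := ⟨algebraMap ℤ R (spinForm ℤ h h * spinForm ℤ s s) • x
      - (algebraMap ℤ R (spinForm ℤ s s) * spinForm R x (extend R h)) • extend R h
      - (algebraMap ℤ R (spinForm ℤ h h) * spinForm R x (extend R s)) • extend R s, by
    have hsh : spinForm ℤ s h = 0 := by rw [spinForm_comm, hperp]
    constructor
    · simp only [map_sub, map_smul, LinearMap.sub_apply, LinearMap.smul_apply, spinForm_extend,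
        hsh, map_zero, smul_eq_mul, map_mul]
      ring
    · simp only [map_sub, map_smul, LinearMap.sub_apply, LinearMap.smul_apply, spinForm_extend,
        hperp, map_zero, smul_eq_mul, map_mul]
      ring⟩
  map_add' x y := by
    ext i
    simp only [map_add, LinearMap.add_apply, Submodule.coe_add, Pi.add_apply, Pi.sub_apply,
      Pi.smul_apply, smul_eq_mul]
    ring
  map_smul' r x := by
    ext i
    simp only [map_smul, LinearMap.smul_apply, Submodule.coe_smul, Pi.sub_apply,
      Pi.smul_apply, smul_eq_mul, RingHom.id_apply]
    ring

variable (hperp : spinForm ℤ h s = 0)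

lemma coe_orthProj {R : Type*} [CommRing R] (x : Fin 8 → R) :
    (orthProj R h s hperp x).1 = algebraMap ℤ R (spinForm ℤ h h * spinForm ℤ s s) • x
      - (algebraMap ℤ R (spinForm ℤ s s) * spinForm R x (extend R h)) • extend R h
      - (algebraMap ℤ R (spinForm ℤ h h) * spinForm R x (extend R s)) • extend R s := rfl

lemma orthProj_coe {R : Type*} [CommRing R] (x : orthLattice R h s) :
    orthProj R h s hperp x.1 = algebraMap ℤ R (spinForm ℤ h h * spinForm ℤ s s) • x := by
  apply Subtype.ext
  rw [coe_orthProj, x.2.1, x.2.2]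
  simp

lemma orthProj_extend {R : Type*} [CommRing R] (x : Fin 8 → ℤ) :
    orthProj R h s hperp (extend R x) = orthExtend R h s (orthProj ℤ h s hperp x) := by
  apply Subtype.ext
  change _ = extend R (orthProj ℤ h s hperp x).1
  rw [coe_orthProj, coe_orthProj]
  simp only [spinForm_extend]
  ext i
  simp [extend]

lemma spinForm_orthProj {R : Type*} [CommRing R] (x : orthLattice R h s) (z : Fin 8 → R) :
    spinForm R x.1 (orthProj R h s hperp z).1
      = algebraMap ℤ R (spinForm ℤ h h * spinForm ℤ s s) * spinForm R x.1 z := by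
  rw [coe_orthProj, map_sub, map_sub, map_smul, map_smul, map_smul, x.2.1, x.2.2]
  simp

variable (hpos : 0 < spinForm ℤ h h) (spos : 0 < spinForm ℤ s s)

include hpos spos in
lemma algebraMap_norm_ne_zero :
    algebraMap ℤ ℂ (spinForm ℤ h h * spinForm ℤ s s) ≠ 0 := by
  simp [hpos.ne', spos.ne']

include hperp hpos spos in
-- The orthogonal projection scaled by (h,h)(s,s) is defined over ℤ, so the scaled projections of
-- the standard basis vectors are integral points of H that span H_ℂ.
lemma span_range_orthExtend :
    Submodule.span ℂ (Set.range (orthExtend ℂ h s : orthLattice ℤ h s → orthLattice ℂ h s)) = ⊤ := by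
  rw [eq_top_iff]
  intro x _
  have hN := algebraMap_norm_ne_zero hpos spos
  rw [← Submodule.smul_mem_iff _ hN, ← orthProj_coe hperp, pi_eq_sum_univ' x.1, map_sum]
  refine Submodule.sum_mem _ fun i _ => ?_
  rw [map_smul]
  refine Submodule.smul_mem _ _ (Submodule.subset_span ⟨orthProj ℤ h s hperp (Pi.single i 1), ?_⟩)
  rw [← orthProj_extend]
  congr 1
  ext j
  simp [extend, Pi.single_apply, eq_comm]

include hperp hpos spos in
-- For x in H_ℂ, pairing with a scaled projection of z is a nonzero multiple of (x, z);
-- nondegeneracy is thus inherited from ℂ⁸, where the standard basis vectors detect coordinates.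
lemma separatingLeft_orthLattice :
    ((spinForm ℂ).restrict (orthLattice ℂ h s)).SeparatingLeft := by
  intro x hx
  have hN := algebraMap_norm_ne_zero hpos spos
  have key : ∀ z, spinForm ℂ x.1 z = 0 := fun z => by
    have := hx (orthProj ℂ h s hperp z)
    change spinForm ℂ x.1 (orthProj ℂ h s hperp z).1 = 0 at this
    rw [spinForm_orthProj, mul_eq_zero] at this
    exact this.resolve_left hN
  apply Subtype.ext
  ext i
  have h0 := key (Pi.single 0 1)
  have h1 := key (Pi.single 1 1)
  have h2 := key (Pi.single 2 1)
  have h3 := key (Pi.single 3 1)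
  have h4 := key (Pi.single 4 1)
  have h5 := key (Pi.single 5 1)
  have h6 := key (Pi.single 6 1)
  have h7 := key (Pi.single 7 1)
  simp [spinForm_apply] at h0 h1 h2 h3 h4 h5 h6 h7
  fin_cases i <;> assumption

include hperp hpos spos in
lemma finrank_orthLattice : Module.finrank ℂ (orthLattice ℂ h s) = 6 := by
  let f : (Fin 8 → ℂ) →ₗ[ℂ] (ℂ × ℂ) :=
    ((spinForm ℂ).flip (extend ℂ h)).prod ((spinForm ℂ).flip (extend ℂ s))
  have hf : ∀ x, f x = (spinForm ℂ x (extend ℂ h), spinForm ℂ x (extend ℂ s)) := fun _ => rfl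
  have hker : LinearMap.ker f = orthLattice ℂ h s := by
    ext x
    rw [LinearMap.mem_ker, hf, Prod.mk_eq_zero]
    rfl
  have hh : algebraMap ℤ ℂ (spinForm ℤ h h) ≠ 0 := by simp [hpos.ne']
  have ss : algebraMap ℤ ℂ (spinForm ℤ s s) ≠ 0 := by simp [spos.ne']
  have hrange : LinearMap.range f = ⊤ := by
    rw [LinearMap.range_eq_top]
    rintro ⟨a, b⟩
    refine ⟨(a / algebraMap ℤ ℂ (spinForm ℤ h h)) • extend ℂ h
      + (b / algebraMap ℤ ℂ (spinForm ℤ s s)) • extend ℂ s, ?_⟩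
    have hsh : spinForm ℤ s h = 0 := by rw [spinForm_comm, hperp]
    rw [hf]
    simp only [map_add, map_smul, LinearMap.add_apply, LinearMap.smul_apply, spinForm_extend,
      hperp, hsh, map_zero, smul_eq_mul, mul_zero, add_zero, zero_add, div_mul_cancel₀ _ hh,
      div_mul_cancel₀ _ ss]
  have h := LinearMap.finrank_range_add_finrank_ker f
  rw [hker, hrange, finrank_top, Module.finrank_prod, Module.finrank_self,
    Module.finrank_fintype_fun_eq_card, Fintype.card_fin] at h
  omega

include hperp hpos spos in
lemma exists_orthogonal_basis_orthLattice :
    ∃ b : Module.Basis (Fin (5 + 1)) ℂ (orthLattice ℂ h s),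
      (∀ i j, i ≠ j → QuadraticMap.IsOrtho (orthForm ℂ h s) (b i) (b j)) ∧
        ∀ i, orthForm ℂ h s (b i) ≠ 0 := by
  obtain ⟨b, hb⟩ := LinearMap.BilinForm.exists_orthogonal_basis
    (B := (spinForm ℂ).restrict (orthLattice ℂ h s)) ⟨fun x y => spinForm_comm x.1 y.1⟩
  rw [LinearMap.isOrthoᵢ_def] at hb
  have e : Module.finrank ℂ (orthLattice ℂ h s) = 5 + 1 := finrank_orthLattice hperp hpos spos
  refine ⟨b.reindex (finCongr e), fun i j hij => ?_, fun i => ?_⟩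
  · have h1 := hb ((finCongr e).symm i) ((finCongr e).symm j) (by simpa using hij)
    have h1' : spinForm ℂ (b.reindex (finCongr e) i).1 (b.reindex (finCongr e) j).1 = 0 := by
      rw [Module.Basis.reindex_apply, Module.Basis.reindex_apply]
      exact h1
    change spinForm ℂ (_ + _) (_ + _) = spinForm ℂ _ _ + spinForm ℂ _ _
    simp only [map_add, LinearMap.add_apply]
    have h2' := (spinForm_comm _ _).trans h1'
    simp only [Submodule.coe_subtype]
    rw [h1', h2']
    ring
  · rw [Module.Basis.reindex_apply]
    exact LinearMap.IsOrthoᵢ.not_isOrtho_basis_self_of_separatingLeft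
      (LinearMap.isOrthoᵢ_def.2 hb) (separatingLeft_orthLattice hperp hpos spos) _

end

end KugaSatakeSpinor

end

noncomputable section

namespace KugaSatakeSpinor

/-! ### The action of the Clifford algebra of `H` on `V` -/

section

variable {R : Type*} [CommRing R]

lemma gamDual_mul_gam_of_perp {x y : Fin 8 → R} (hxy : spinForm R x y = 0) :
    gamDual x * gam y = -(gamDual y * gam x) := by
  rw [eq_neg_iff_add_eq_zero, gamDual_mul_gam_add, hxy, mul_zero, zero_smul]

lemma gam_mul_gamDual_of_perp {x y : Fin 8 → R} (hxy : spinForm R x y = 0) :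
    gam x * gamDual y = -(gam y * gamDual x) := by
  rw [eq_neg_iff_add_eq_zero, gam_mul_gamDual_add, hxy, mul_zero, zero_smul]

/-- Moving γ*(u) across γ(x) costs a sign and creates γ*(u)γ(u) = (u, u). With u = h it gives the
Clifford relation for `spinRep` and, for x = y = s, the square of J; with u = f₁ and x = y = f₂ it
gives the square of f₁f₂. -/
lemma gamDual_gam_mul_gamDual_gam {u x : Fin 8 → R} (hx : spinForm R x u = 0) (y : Fin 8 → R) :
    gamDual u * gam x * (gamDual u * gam y) = -(spinForm R u u • (gamDual x * gam y)) := by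
  calc gamDual u * gam x * (gamDual u * gam y)
      = gamDual u * (gam x * gamDual u) * gam y := by simp only [mul_assoc]
    _ = -(gamDual u * gam u * (gamDual x * gam y)) := by
        rw [gam_mul_gamDual_of_perp hx]; simp only [mul_neg, neg_mul, mul_assoc]
    _ = _ := by rw [gamDual_mul_gam_self, Matrix.smul_mul, one_mul]

end

section

variable {h s : Fin 8 → ℤ}

/-- A homomorphism from the Clifford algebra of `H_ℂ` to the endomorphisms of `V_ℂ` whose
restriction to the even Clifford algebra is its action on the half-spin space `V_ℂ`. -/
def spinRep (s : Fin 8 → ℤ) {c : ℂ} (hc : c * c * spinForm ℂ (extend ℂ h) (extend ℂ h) = -1) :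
    CliffordAlgebra (orthForm ℂ h s) →ₐ[ℂ] Matrix (Fin 4 ⊕ Fin 4) (Fin 4 ⊕ Fin 4) ℂ :=
  CliffordAlgebra.lift (orthForm ℂ h s)
    ⟨{ toFun := fun x => c • (gamDual (extend ℂ h) * gam x.1)
       map_add' := fun x y => by rw [Submodule.coe_add, gam_add, mul_add, smul_add]
       map_smul' := fun r x => by
        rw [Submodule.coe_smul, gam_smul, Matrix.mul_smul, smul_comm, RingHom.id_apply] },
      fun x => by
        simp only [LinearMap.coe_mk, AddHom.coe_mk]
        rw [Matrix.smul_mul, Matrix.mul_smul, gamDual_gam_mul_gamDual_gam x.2.1, smul_neg, smul_neg,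
          smul_smul, smul_smul, hc, neg_smul, neg_neg, one_smul, gamDual_mul_gam_self,
          Algebra.algebraMap_eq_smul_one]
        rfl⟩

variable (hperp : spinForm ℤ h s = 0) {c : ℂ} (hc : c * c * spinForm ℂ (extend ℂ h) (extend ℂ h) = -1)

lemma spinRep_ι (x : orthLattice ℂ h s) :
    spinRep s hc (CliffordAlgebra.ι _ x) = c • (gamDual (extend ℂ h) * gam x.1) := by
  rw [spinRep, CliffordAlgebra.lift_ι_apply]
  rfl

/-- The auxiliary constant `c` cancels in products of two vectors, so the even part acts by matrices
that are integral for integral vectors. -/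
lemma spinRep_ι_mul_ι (x y : orthLattice ℂ h s) :
    spinRep s hc (CliffordAlgebra.ι _ x * CliffordAlgebra.ι _ y) = gamDual x.1 * gam y.1 := by
  rw [map_mul, spinRep_ι, spinRep_ι, Matrix.smul_mul, Matrix.mul_smul,
    gamDual_gam_mul_gamDual_gam x.2.1, smul_neg, smul_neg, smul_smul, smul_smul, hc, neg_smul,
    neg_neg, one_smul]

include hperp in
lemma spinForm_extend_eq_zero : spinForm ℂ (extend ℂ s) (extend ℂ h) = 0 := by
  rw [spinForm_extend, spinForm_comm, hperp, map_zero]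

include hperp in
-- Up to scalars, s acts like one more Clifford generator orthogonal to H: it anticommutes with
-- every vector of H_ℂ, hence commutes with the even part.
lemma spinRep_ι_mul (x : orthLattice ℂ h s) :
    spinRep s hc (CliffordAlgebra.ι _ x) * (gamDual (extend ℂ h) * gam (extend ℂ s))
      = -(gamDual (extend ℂ h) * gam (extend ℂ s) * spinRep s hc (CliffordAlgebra.ι _ x)) := by
  rw [spinRep_ι, Matrix.smul_mul, Matrix.mul_smul, gamDual_gam_mul_gamDual_gam x.2.1,
    gamDual_mul_gam_of_perp x.2.2,
    gamDual_gam_mul_gamDual_gam (spinForm_extend_eq_zero hperp)]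
  simp only [smul_neg]

include hperp in
lemma spinRep_mul_comm {a : CliffordAlgebra (orthForm ℂ h s)}
    (ha : a ∈ CliffordAlgebra.even (orthForm ℂ h s)) :
    spinRep s hc a * (gamDual (extend ℂ h) * gam (extend ℂ s))
      = gamDual (extend ℂ h) * gam (extend ℂ s) * spinRep s hc a := by
  rw [← Subalgebra.mem_toSubmodule, CliffordAlgebra.even_toSubmodule] at ha
  induction a, ha using CliffordAlgebra.even_induction with
  | algebraMap r => rw [AlgHom.commutes, Algebra.commutes]
  | add x y _ _ hx hy => rw [map_add, add_mul, mul_add, hx, hy]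
  | ι_mul_ι_mul m₁ m₂ x _ hx =>
    rw [map_mul, map_mul, mul_assoc, hx, ← mul_assoc, mul_assoc (spinRep s hc _),
      spinRep_ι_mul hperp, mul_neg, ← mul_assoc, spinRep_ι_mul hperp]
    simp only [neg_mul, neg_neg, mul_assoc]

lemma cliffordExtend_ι (m : orthLattice ℤ h s) :
    cliffordExtend h s (CliffordAlgebra.ι _ m)
      = CliffordAlgebra.ι _ (orthExtend ℂ h s m) := by
  rw [cliffordExtend, CliffordAlgebra.lift_ι_apply]
  rfl

lemma exists_intMatrix_spinRep {y : CliffordAlgebra (orthForm ℤ h s)}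
    (hy : y ∈ CliffordAlgebra.even (orthForm ℤ h s)) :
    ∃ Y : Matrix (Fin 4 ⊕ Fin 4) (Fin 4 ⊕ Fin 4) ℤ,
      spinRep s hc (cliffordExtend h s y) = Y.map (algebraMap ℤ ℂ) := by
  rw [← Subalgebra.mem_toSubmodule, CliffordAlgebra.even_toSubmodule] at hy
  induction y, hy using CliffordAlgebra.even_induction with
  | algebraMap r =>
    refine ⟨r • 1, ?_⟩
    rw [Algebra.algebraMap_eq_smul_one, map_zsmul, map_zsmul, map_one, map_one]
    ext i j
    rw [Matrix.map_apply, Matrix.smul_apply, Matrix.smul_apply, Matrix.one_apply, Matrix.one_apply]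
    split_ifs <;> simp
  | add x y _ _ hx hy =>
    obtain ⟨X, hX⟩ := hx
    obtain ⟨Y, hY⟩ := hy
    refine ⟨X + Y, ?_⟩
    rw [map_add, map_add, hX, hY, Matrix.map_add _ (map_add _)]
  | ι_mul_ι_mul m₁ m₂ x _ hx =>
    obtain ⟨X, hX⟩ := hx
    refine ⟨gamDual m₁.1 * gam m₂.1 * X, ?_⟩
    rw [map_mul, map_mul, map_mul, hX, cliffordExtend_ι, cliffordExtend_ι, spinRep_ι_mul_ι,
      Matrix.map_mul, Matrix.map_mul, ← gam_extend, ← gamDual_extend]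
    rfl

lemma cliffordExtend_mem_even {y : CliffordAlgebra (orthForm ℤ h s)}
    (hy : y ∈ CliffordAlgebra.even (orthForm ℤ h s)) :
    cliffordExtend h s y ∈ CliffordAlgebra.even (orthForm ℂ h s) := by
  rw [← Subalgebra.mem_toSubmodule, CliffordAlgebra.even_toSubmodule] at hy
  induction y, hy using CliffordAlgebra.even_induction with
  | algebraMap r =>
    rw [Algebra.algebraMap_eq_smul_one, map_zsmul, map_one]
    exact zsmul_mem (one_mem _) r
  | add x y _ _ hx hy =>
    rw [map_add]
    exact add_mem hx hy
  | ι_mul_ι_mul m₁ m₂ x _ hx =>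
    rw [map_mul, map_mul, cliffordExtend_ι, cliffordExtend_ι]
    exact mul_mem (CliffordAlgebra.ι_mul_ι_mem_evenOdd_zero _ _ _) hx

variable (hpos : 0 < spinForm ℤ h h) (spos : 0 < spinForm ℤ s s)

include hperp hpos spos in
lemma span_evenLattice : Submodule.span ℂ (evenLattice h s : Set (EvenCl ℂ h s)) = ⊤ := by
  let E : Set (CliffordAlgebra (orthForm ℂ h s)) :=
    cliffordExtend h s '' (CliffordAlgebra.even (orthForm ℤ h s) : Set _)
  let G : Set (CliffordAlgebra (orthForm ℂ h s)) :=
    Set.range fun m : orthLattice ℤ h s => CliffordAlgebra.ι _ (orthExtend ℂ h s m)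
  have hG : ∀ m, CliffordAlgebra.ι (orthForm ℂ h s) m ∈ Submodule.span ℂ G := fun m => by
    have hm : m ∈ Submodule.span ℂ (Set.range (orthExtend ℂ h s : orthLattice ℤ h s → _)) :=
      span_range_orthExtend hperp hpos spos ▸ Submodule.mem_top
    have := Submodule.mem_map_of_mem (f := CliffordAlgebra.ι (orthForm ℂ h s)) hm
    rwa [Submodule.map_span, ← Set.range_comp] at this
  -- The complex span of the image of C(H)⁺ is stable under products of two vectors of H_ℂ, since H
  -- spans H_ℂ. This is the inductive step for even elements.
  have hE : Submodule.span ℂ G * Submodule.span ℂ G * Submodule.span ℂ E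
      ≤ Submodule.span ℂ E := by
    rw [Submodule.span_mul_span, Submodule.span_mul_span, Submodule.span_le]
    rintro _ ⟨_, ⟨_, ⟨m₁, rfl⟩, _, ⟨m₂, rfl⟩, rfl⟩, _, ⟨y, hy, rfl⟩, rfl⟩
    refine Submodule.subset_span ⟨CliffordAlgebra.ι _ m₁ * CliffordAlgebra.ι _ m₂ * y,
      mul_mem (CliffordAlgebra.ι_mul_ι_mem_evenOdd_zero _ _ _) hy, ?_⟩
    simp only [map_mul, cliffordExtend_ι]
  have key : ∀ a ∈ CliffordAlgebra.evenOdd (orthForm ℂ h s) 0, a ∈ Submodule.span ℂ E := by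
    intro a ha
    induction a, ha using CliffordAlgebra.even_induction with
    | algebraMap r =>
      rw [Algebra.algebraMap_eq_smul_one]
      exact Submodule.smul_mem _ _ (Submodule.subset_span ⟨1, one_mem _, map_one _⟩)
    | add x y _ _ hx hy => exact add_mem hx hy
    | ι_mul_ι_mul m₁ m₂ x _ hx =>
      exact hE (Submodule.mul_mem_mul (Submodule.mul_mem_mul (hG m₁) (hG m₂)) hx)
  rw [eq_top_iff]
  intro a _
  have hval : (Subalgebra.val (CliffordAlgebra.even (orthForm ℂ h s))).toLinearMap ''
      (evenLattice h s : Set (EvenCl ℂ h s)) = E := by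
    ext x
    constructor
    · rintro ⟨a, ⟨y, hy, hya⟩, rfl⟩
      exact ⟨y, hy, hya⟩
    · rintro ⟨y, hy, rfl⟩
      exact ⟨⟨_, cliffordExtend_mem_even hy⟩, ⟨y, hy, rfl⟩, rfl⟩
  have ha := key a.1 a.2
  rw [← hval, ← Submodule.map_span] at ha
  obtain ⟨a', ha', e⟩ := ha
  rwa [← Subtype.ext (show a'.1 = a.1 from e)]

include hperp hpos spos in
/-- The even Clifford algebra of `H_ℂ` is isomorphic to `V_ℂ ^ 4` as a module, such that its
lattice has integral coordinates. -/
lemma exists_evenCl_equiv :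
    ∃ Φ : EvenCl ℂ h s ≃ₗ[ℂ] (Fin 4 → Fin 4 ⊕ Fin 4 → ℂ),
      (∀ (x y : orthLattice ℂ h s) (a b : EvenCl ℂ h s),
        CliffordAlgebra.ι _ x * CliffordAlgebra.ι _ y * a.1 = b.1 →
          ∀ k, Φ b k = (gamDual x.1 * gam y.1).mulVec (Φ a k)) ∧
      ∀ a ∈ evenLattice h s, ∃ n : Fin 4 → Fin 4 ⊕ Fin 4 → ℤ, Φ a = fun k i => (n k i : ℂ) := by
  obtain ⟨c, hc⟩ : ∃ c : ℂ, c * c * spinForm ℂ (extend ℂ h) (extend ℂ h) = -1 := by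
    have hh : algebraMap ℤ ℂ (spinForm ℤ h h) ≠ 0 := by simp [hpos.ne']
    obtain ⟨c, hc⟩ := IsAlgClosed.exists_pow_nat_eq
      (-(algebraMap ℤ ℂ (spinForm ℤ h h))⁻¹) (n := 2) two_pos
    refine ⟨c, ?_⟩
    rw [← sq, hc, spinForm_extend, neg_mul, inv_mul_cancel₀ hh]
  have hJ : gamDual h * gam s * (gamDual h * gam s)
      = -((spinForm ℤ h h * spinForm ℤ s s) • (1 : Matrix (Fin 4 ⊕ Fin 4) (Fin 4 ⊕ Fin 4) ℤ)) := by
    rw [gamDual_gam_mul_gamDual_gam (by rw [spinForm_comm, hperp]), gamDual_mul_gam_self, mul_smul]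
  -- The four indices `k i` select the vectors vᵢ for which the vᵢ and Jvᵢ together span V.
  obtain ⟨k, hk⟩ := exists_columns_detecting_zero (m := 4) (by simp) _ (mul_pos hpos spos) hJ
  obtain ⟨b, hb, hQ⟩ := exists_orthogonal_basis_orthLattice hperp hpos spos
  let T := spinRep s hc
  let f : EvenCl ℂ h s →ₗ[ℂ] (Fin 4 → Fin 4 ⊕ Fin 4 → ℂ) :=
    { toFun := fun a i => (T a.1).mulVec (Pi.single (k i) 1)
      map_add' := fun a a' => by
        ext i : 1
        rw [Subalgebra.coe_add, map_add, Matrix.add_mulVec]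
        rfl
      map_smul' := fun r a => by
        ext i : 1
        rw [Subalgebra.coe_smul, map_smul, Matrix.smul_mulVec]
        rfl }
  have hf : ∀ a i, f a i = (T a.1).mulVec (Pi.single (k i) 1) := fun _ _ => rfl
  have hinj : Function.Injective f := by
    rw [injective_iff_map_eq_zero]
    intro a ha
    have hcol : ∀ i, (T a.1).mulVec (Pi.single (k i) 1) = 0 := fun i => by rw [← hf, ha]; rfl
    have hTa : T a.1 = 0 := by
      -- T(a) commutes with J, so T(a)Jvᵢ = J T(a)vᵢ = 0.
      refine hk _ hcol fun i => ?_
      rw [Matrix.map_mul, ← gamDual_extend, ← gam_extend, spinRep_mul_comm hperp hc a.2,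
        ← Matrix.mulVec_mulVec, hcol, Matrix.mulVec_zero]
    exact Subtype.ext (eq_zero_of_mem_even _ b hb hQ T a.2 hTa)
  have hrank : Module.finrank ℂ (EvenCl ℂ h s) = 32 := finrank_even _ b hb hQ
  have hfin : FiniteDimensional ℂ (EvenCl ℂ h s) := Module.finite_of_finrank_pos (by omega)
  -- Both dimensions are 32: 2⁵ for the even Clifford algebra of a space of dimension 6, and 4 · 8
  -- for V_ℂ⁴.
  let Φ := LinearEquiv.ofInjectiveOfFinrankEq f hinj (by
    rw [hrank, Module.finrank_pi_fintype]
    simp)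
  refine ⟨Φ, ?_, ?_⟩
  · intro x y a a' ha i
    change f a' i = Matrix.mulVec _ (f a i)
    rw [hf, hf, ← ha, map_mul, spinRep_ι_mul_ι, Matrix.mulVec_mulVec]
  · rintro a ⟨y, hy, hya⟩
    obtain ⟨Y, hY⟩ := exists_intMatrix_spinRep hc hy
    refine ⟨fun i j => Y j (k i), ?_⟩
    ext i j
    change f a i j = _
    rw [hf, ← hya, hY]
    simp

/-! ### The complex structure on `V_ℝ` -/

/-- The real and imaginary parts of (f₁ + if₂, f₁ + if₂) = 0 give (f₂, f₂) = (f₁, f₁) = 1 and (f₁,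
f₂) = 0, whence the square. Since γ*(f₁) and γ(f₁) are mutually inverse, γ(f₁)v + iγ(f₂)v = 0 is
equivalent to the eigenvector equation. -/
lemma exists_complexStructure {l : Projectivization ℂ (Fin 8 → ℂ)}
    (hl : l ∈ periodDomain h s) {f₁ f₂ : orthLattice ℝ h s} (hf : IsNormalizedPair h s l f₁ f₂) :
    (gamDual f₁.1 * gam f₂.1 * (gamDual f₁.1 * gam f₂.1) = -1) ∧
      ∀ v : VC, v ∈ isotropicSpace l ↔
        (gamDual (extend ℂ f₁.1) * gam (extend ℂ f₂.1)).mulVec (coordV v)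
          = Complex.I • coordV v := by
  obtain ⟨h1, h2⟩ := hf
  rw [Projectivization.submodule_eq] at h2
  have hone : spinForm ℝ f₁.1 f₁.1 = 1 := h1
  obtain ⟨p, hp⟩ := Submodule.mem_span_singleton.1 (h2 ▸ Submodule.mem_span_singleton_self _ :
    extend ℂ f₁.1 + Complex.I • extend ℂ f₂.1 ∈ Submodule.span ℂ {l.rep})
  obtain ⟨q, hq⟩ := Submodule.mem_span_singleton.1 (h2 ▸ Submodule.mem_span_singleton_self _ :
    l.rep ∈ Submodule.span ℂ {extend ℂ f₁.1 + Complex.I • extend ℂ f₂.1})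
  have hiso : spinForm ℂ (extend ℂ f₁.1 + Complex.I • extend ℂ f₂.1)
      (extend ℂ f₁.1 + Complex.I • extend ℂ f₂.1) = 0 := by
    rw [← hp]
    simp [hl.1]
  simp only [map_add, map_smul, LinearMap.add_apply, LinearMap.smul_apply, spinForm_extend,
    spinForm_comm f₂.1 f₁.1, hone, smul_eq_mul, Complex.coe_algebraMap] at hiso
  have hre := congrArg Complex.re hiso
  have him := congrArg Complex.im hiso
  simp at hre him
  constructor
  · rw [gamDual_gam_mul_gamDual_gam (by rw [spinForm_comm]; linarith), hone, one_smul,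
      gamDual_mul_gam_self, show spinForm ℝ f₂.1 f₂.1 = 1 by linarith, one_smul]
  · intro v
    have hdg : gamDual (extend ℂ f₁.1) * gam (extend ℂ f₁.1) = 1 := by
      rw [gamDual_mul_gam_self, spinForm_extend, hone, map_one, one_smul]
    have hgd : gam (extend ℂ f₁.1) * gamDual (extend ℂ f₁.1) = 1 := by
      rw [gam_mul_gamDual_self, spinForm_extend, hone, map_one, one_smul]
    have hmem : v ∈ isotropicSpace l ↔ (gam (extend ℂ f₁.1)).mulVec (coordV v)
        + Complex.I • (gam (extend ℂ f₂.1)).mulVec (coordV v) = 0 := by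
      rw [mem_isotropicSpace, ← Matrix.smul_mulVec, ← Matrix.add_mulVec, ← gam_smul, ← gam_add]
      constructor
      · intro h0
        rw [← hp, gam_smul, Matrix.smul_mulVec, h0, smul_zero]
      · intro h0
        rw [← hq, gam_smul, Matrix.smul_mulVec, h0, smul_zero]
    rw [hmem]
    constructor
    · intro h0
      have := congrArg (fun w => Complex.I • (gamDual (extend ℂ f₁.1)).mulVec w) h0
      simp only [Matrix.mulVec_add, Matrix.mulVec_smul, Matrix.mulVec_mulVec, hdg,
        Matrix.one_mulVec, Matrix.mulVec_zero, smul_zero, smul_add, smul_smul, Complex.I_mul_I,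
        neg_smul, one_smul] at this
      exact (add_neg_eq_zero.1 this).symm
    · intro h0
      have := congrArg (fun w => (gam (extend ℂ f₁.1)).mulVec w) h0
      simp only [Matrix.mulVec_mulVec, ← mul_assoc, hgd, one_mul, Matrix.mulVec_smul] at this
      rw [this, smul_smul, Complex.I_mul_I, neg_smul, one_smul, add_neg_cancel]

/-- A real matrix has no nonzero real eigenvector with eigenvalue i: compare imaginary parts. -/
lemma eq_zero_of_real_mem_isotropicSpace {l : Projectivization ℂ (Fin 8 → ℂ)}
    (hl : l ∈ periodDomain h s) (r : Fin 4 ⊕ Fin 4 → ℝ)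
    (hr : coordV.symm (fun i => (r i : ℂ)) ∈ isotropicSpace l) : r = 0 := by
  obtain ⟨f₁, f₂, hf⟩ := exists_isNormalizedPair h s l hl
  rw [(exists_complexStructure hl hf).2, LinearEquiv.apply_symm_apply, gam_extend, gamDual_extend,
    ← Matrix.map_mul] at hr
  ext i
  have := congrArg Complex.im (congrFun hr i)
  simp [Matrix.mulVec, dotProduct] at this
  exact this.symm

lemma exists_real_sub_mem_isotropicSpace {l : Projectivization ℂ (Fin 8 → ℂ)}
    (hl : l ∈ periodDomain h s) (v : VC) :
    ∃ r : Fin 4 ⊕ Fin 4 → ℝ, v - coordV.symm (fun i => (r i : ℂ)) ∈ isotropicSpace l := by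
  obtain ⟨f₁, f₂, hf⟩ := exists_isNormalizedPair h s l hl
  obtain ⟨hJ, hmem⟩ := exists_complexStructure hl hf
  let J := gamDual f₁.1 * gam f₂.1
  let x : Fin 4 ⊕ Fin 4 → ℝ := fun i => (coordV v i).re
  let y : Fin 4 ⊕ Fin 4 → ℝ := fun i => (coordV v i).im
  -- For v = x + iy the difference v - (x - Jy) is Jy + iy, and J(Jy + iy) = -y + iJy = i(Jy + iy).
  refine ⟨x - J.mulVec y, ?_⟩
  have hJC : gamDual (extend ℂ f₁.1) * gam (extend ℂ f₂.1) = J.map (algebraMap ℝ ℂ) := by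
    rw [gam_extend, gamDual_extend, ← Matrix.map_mul]
  have hJJ : J.map (algebraMap ℝ ℂ) * J.map (algebraMap ℝ ℂ) = -1 := by
    rw [← Matrix.map_mul, hJ]
    ext i j
    rw [Matrix.map_apply, Matrix.neg_apply, Matrix.neg_apply, Matrix.one_apply, Matrix.one_apply]
    split_ifs <;> simp
  have hy : (fun i => ((J.mulVec y i : ℝ) : ℂ))
      = (J.map (algebraMap ℝ ℂ)).mulVec fun i => (y i : ℂ) := by
    ext i
    simp [Matrix.mulVec, dotProduct]
  have hw : coordV (v - coordV.symm (fun i => (((x - J.mulVec y) i : ℝ) : ℂ)))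
      = (J.map (algebraMap ℝ ℂ)).mulVec (fun i => (y i : ℂ)) + Complex.I • fun i => (y i : ℂ) := by
    rw [map_sub, LinearEquiv.apply_symm_apply, ← hy]
    ext i
    simp only [Pi.sub_apply, Pi.add_apply, Pi.smul_apply, smul_eq_mul, Complex.ofReal_sub]
    have := Complex.re_add_im (coordV v i)
    linear_combination -this
  rw [hmem, hJC, hw, Matrix.mulVec_add, Matrix.mulVec_smul, Matrix.mulVec_mulVec, hJJ, smul_add,
    smul_smul, Complex.I_mul_I, Matrix.neg_mulVec, Matrix.one_mulVec, neg_smul, one_smul, add_comm]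

end

end KugaSatakeSpinor

end

noncomputable section

namespace KugaSatakeSpinor

/-! ### The tori -/

section

variable {h s : Fin 8 → ℤ} {l : Projectivization ℂ (Fin 8 → ℂ)}

lemma mem_latticeV (v : VC) :
    v ∈ latticeV ↔ ∃ n : Fin 4 ⊕ Fin 4 → ℤ, coordV v = fun i => (n i : ℂ) := by
  constructor
  · rintro ⟨a, b, rfl⟩
    refine ⟨Sum.elim a b, ?_⟩
    ext i
    rcases i with i | i <;> rfl
  · rintro ⟨n, hn⟩
    exact ⟨fun i => n (.inl i), fun i => n (.inr i),
      Prod.ext (funext fun i => congrFun hn (.inl i)) (funext fun i => congrFun hn (.inr i))⟩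

lemma sum_smul_coordV_single (a : Fin 4 ⊕ Fin 4 → ℂ) :
    ∑ i, a i • coordV.symm (Pi.single i 1) = coordV.symm a := by
  conv_rhs => rw [pi_eq_sum_univ' a]
  simp only [map_sum, map_smul]

lemma closure_range_coordV :
    AddSubgroup.closure (Set.range fun i => coordV.symm (Pi.single i 1)) = latticeV := by
  refine le_antisymm ((AddSubgroup.closure_le _).2 ?_) fun v hv => ?_
  · rintro _ ⟨i, rfl⟩
    refine (mem_latticeV _).2 ⟨Pi.single i 1, ?_⟩
    rw [LinearEquiv.apply_symm_apply]
    ext j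
    simp only [Pi.single_apply]
    split_ifs <;> simp
  · obtain ⟨n, hn⟩ := (mem_latticeV v).1 hv
    rw [← coordV.symm_apply_apply v, hn, ← sum_smul_coordV_single]
    refine sum_mem fun i _ => ?_
    rw [Int.cast_smul_eq_zsmul]
    exact zsmul_mem (AddSubgroup.subset_closure (Set.mem_range_self i)) _

lemma isComplexTorus_torusT (hl : l ∈ periodDomain h s) : IsComplexTorus 4 (torusT l) := by
  rw [torusT, ← closure_range_coordV]
  refine isComplexTorus_periodLattice (by simp) _ _ (fun a ha => ?_) fun v => ?_
  · rw [sum_smul_coordV_single fun i => (a i : ℂ)] at ha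
    exact eq_zero_of_real_mem_isotropicSpace hl a ha
  · obtain ⟨r, hr⟩ := exists_real_sub_mem_isotropicSpace hl v
    exact ⟨r, by rwa [sum_smul_coordV_single fun i => (r i : ℂ)]⟩

/-- The Hodge structures on `C(H)^+` and on `V ^ 4` agree. -/
lemma mem_kugaSatakeOneZero (hl : l ∈ periodDomain h s)
    (Φ : EvenCl ℂ h s ≃ₗ[ℂ] (Fin 4 → Fin 4 ⊕ Fin 4 → ℂ))
    (hΦ : ∀ (x y : orthLattice ℂ h s) (a b : EvenCl ℂ h s),
      CliffordAlgebra.ι _ x * CliffordAlgebra.ι _ y * a.1 = b.1 →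
        ∀ k, Φ b k = (gamDual x.1 * gam y.1).mulVec (Φ a k)) (a : EvenCl ℂ h s) :
    a ∈ kugaSatakeOneZero h s l ↔ ∀ k, coordV.symm (Φ a k) ∈ isotropicSpace l := by
  have key : ∀ f₁ f₂ : orthLattice ℝ h s, IsNormalizedPair h s l f₁ f₂ →
      (CliffordAlgebra.ι (orthForm ℂ h s) (orthExtend ℂ h s f₁)
        * CliffordAlgebra.ι (orthForm ℂ h s) (orthExtend ℂ h s f₂) * a.1 = Complex.I • a.1 ↔
        ∀ k, coordV.symm (Φ a k) ∈ isotropicSpace l) := by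
    intro f₁ f₂ hf
    let b : EvenCl ℂ h s := ⟨_, mul_mem (CliffordAlgebra.ι_mul_ι_mem_evenOdd_zero _
      (orthExtend ℂ h s f₁) (orthExtend ℂ h s f₂)) a.2⟩
    have hb : b = Complex.I • a ↔ Φ b = Φ (Complex.I • a) := Φ.injective.eq_iff.symm
    refine Iff.trans (b := b = Complex.I • a) ⟨fun e => Subtype.ext e, congrArg Subtype.val⟩ ?_
    rw [hb, funext_iff]
    refine forall_congr' fun k => ?_
    rw [hΦ _ _ a b rfl, (exists_complexStructure hl hf).2, LinearEquiv.apply_symm_apply, map_smul]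
    rfl
  -- Membership in C^{1,0} quantifies over all normalized pairs; existence of one keeps the
  -- condition from being vacuous, and by `key` every pair gives the same condition.
  obtain ⟨f₁, f₂, hf⟩ := exists_isNormalizedPair h s l hl
  exact ⟨fun ha => (key f₁ f₂ hf).1 (ha f₁ f₂ hf), fun ha g₁ g₂ hg => (key g₁ g₂ hg).2 ha⟩

lemma isComplexTorus_kugaSatakeA (hl : l ∈ periodDomain h s)
    (Φ : EvenCl ℂ h s ≃ₗ[ℂ] (Fin 4 → Fin 4 ⊕ Fin 4 → ℂ))
    (hΦ : ∀ a, a ∈ kugaSatakeOneZero h s l ↔ ∀ k, coordV.symm (Φ a k) ∈ isotropicSpace l)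
    (hint : ∀ a ∈ evenLattice h s, ∃ n : Fin 4 → Fin 4 ⊕ Fin 4 → ℤ,
      Φ a = fun k i => (n k i : ℂ))
    (b : Module.Basis (Fin 4 × (Fin 4 ⊕ Fin 4)) ℂ (EvenCl ℂ h s))
    (hb : AddSubgroup.closure (Set.range b) = evenLattice h s) :
    IsComplexTorus 16 (kugaSatakeA h s l) := by
  have hbint : ∀ p, ∃ n : Fin 4 → Fin 4 ⊕ Fin 4 → ℤ, Φ (b p) = fun k i => (n k i : ℂ) :=
    fun p => hint _ (hb ▸ AddSubgroup.subset_closure ⟨p, rfl⟩)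
  choose n hn using hbint
  have hsum : ∀ (a : Fin 4 × (Fin 4 ⊕ Fin 4) → ℂ) k i,
      Φ (∑ p, a p • b p) k i = ∑ p, a p * (n p k i : ℂ) := by
    intro a k i
    simp only [map_sum, map_smul, hn, Finset.sum_apply, Pi.smul_apply, smul_eq_mul]
  rw [kugaSatakeA, ← hb]
  refine isComplexTorus_periodLattice (by simp) _ _ (fun a ha => ?_) fun x => ?_
  · rw [hΦ] at ha
    -- A real combination of lattice vectors has real coordinates in each copy of V_ℂ, and Z_ℓ
    -- contains no nonzero real vector.
    have hzero : ∑ p, (a p : ℂ) • b p = 0 := by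
      rw [← map_eq_zero_iff Φ Φ.injective]
      ext k i
      have hreal : Φ (∑ p, (a p : ℂ) • b p) k
          = fun i => ((∑ p, a p * (n p k i : ℝ) : ℝ) : ℂ) := by
        ext i
        rw [hsum]
        simp
      have h0 := ha k
      rw [hreal] at h0 ⊢
      have := congrFun (eq_zero_of_real_mem_isotropicSpace hl _ h0) i
      simp only [Pi.zero_apply] at this
      simp only [this, Complex.ofReal_zero, Pi.zero_apply]
    have := Fintype.linearIndependent_iff.1 b.linearIndependent _ hzero
    ext p
    exact_mod_cast this p
  · choose r hr using fun k => exists_real_sub_mem_isotropicSpace hl (coordV.symm (Φ x k))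
    let y := Φ.symm fun k i => (r k i : ℂ)
    have hy : Φ y = fun k i => (r k i : ℂ) := LinearEquiv.apply_symm_apply _ _
    -- The basis vectors have integral coordinates and y has real ones, so replacing the
    -- coefficients of y by their real parts does not change the vector.
    refine ⟨fun p => (b.repr y p).re, ?_⟩
    have hyre : Φ (∑ p, ((b.repr y p).re : ℂ) • b p) = Φ y := by
      ext k i
      have h1 := hsum (b.repr y) k i
      rw [b.sum_repr, hy] at h1
      have h2 := congrArg Complex.re h1
      rw [hsum, hy]
      simp only [Complex.ofReal_re, Complex.re_sum, Complex.mul_re, Complex.intCast_re,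
        Complex.intCast_im, mul_zero, sub_zero] at h2
      change _ = (r k i : ℂ)
      rw [h2]
      push_cast
      rfl
    rw [Φ.injective hyre, hΦ]
    intro k
    rw [map_sub, hy, Pi.sub_apply, map_sub]
    exact hr k

end

end KugaSatakeSpinor

end

theorem mainTheorem6 (h s : Fin 8 → ℤ)
    (hperp : KugaSatakeSpinor.spinForm ℤ h s = 0)
    (hpos : 0 < KugaSatakeSpinor.spinForm ℤ h h)
    (spos : 0 < KugaSatakeSpinor.spinForm ℤ s s)
    (l : Projectivization ℂ (Fin 8 → ℂ))
    (hl : l ∈ KugaSatakeSpinor.periodDomain h s) :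
    KugaSatakeSpinor.IsComplexTorus 4 (KugaSatakeSpinor.torusT l) ∧
    KugaSatakeSpinor.IsComplexTorus 16 (KugaSatakeSpinor.kugaSatakeA h s l) ∧
    KugaSatakeSpinor.Isogenous (KugaSatakeSpinor.kugaSatakeA h s l)
      (KugaSatakeSpinor.powLattice 4 (KugaSatakeSpinor.torusT l)) := by
  open KugaSatakeSpinor in
  obtain ⟨Φ, hΦ, hint⟩ := exists_evenCl_equiv hperp hpos spos
  have hF := mem_kugaSatakeOneZero hl Φ hΦ
  -- Uncurrying flattens V_ℂ⁴ to ℂ³², so one application gives both a lattice basis and finitely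
  -- many representatives for V⁴ modulo the image of C(H)⁺.
  obtain ⟨⟨b, hb⟩, S, hS, hSn⟩ := exists_basis_of_integral
    (Φ.trans (LinearEquiv.curry ℂ ℂ (Fin 4) (Fin 4 ⊕ Fin 4)).symm) (evenLattice h s)
    (fun a ha => by
      obtain ⟨n, hn⟩ := hint a ha
      refine ⟨Function.uncurry n, ?_⟩
      rw [LinearEquiv.trans_apply, hn]
      rfl) (span_evenLattice hperp hpos spos)
  refine ⟨isComplexTorus_torusT hl, isComplexTorus_kugaSatakeA hl Φ hF hint b hb,
    isogenous_powLattice (Φ.trans (LinearEquiv.piCongrRight fun _ => coordV.symm)) _ _ _ _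
      hF (fun a ha k => ?_) hS fun y hy => ?_⟩
  · obtain ⟨n, hn⟩ := hint a ha
    refine (mem_latticeV _).2 ⟨n k, ?_⟩
    change coordV (coordV.symm (Φ a k)) = _
    rw [LinearEquiv.apply_symm_apply, hn]
  · choose n hn using fun k => (mem_latticeV _).1 (hy k)
    obtain ⟨t, ht, hmem⟩ := hSn (Function.uncurry n)
    refine ⟨t, ht, ?_⟩
    convert hmem using 2
    change Φ.symm _ = Φ.symm _
    congr 1
    ext k i
    exact congrFun (hn k) i
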